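/- Let $\mathbb F_3^{\mathbb N}$ be the space of finitely supported sequences $x=(x_i)_{i\ge 0}$ over $\mathbb F_3=\{0,1,2\}$, with Hamming distance $d(x,y)=|\{i: x_i\ne y_i\}|$ and standard basis $E=(e_0,e_1,\dots)$. For an ordered basis $F=(f_i)_{i\in\mathbb N}$ write $x=\sum_i x_{[i;F]}f_i$, and for $x\neq y$ let $x<_F y$ if $x_{[N;F]}<y_{[N;F]}$ (as elements of $0<1<2$) at the largest index $N$ with $x_{[N;F]}\ne y_{[N;F]}$. Define recursively $w_{F}(a)$, $a=0,1,2,\dots$, as the $<_F$-minimum of all $z\in\mathbb F_3^{\mathbb N}$ with $d(z,w_{F}(b))\ge 6$ for all $0\le b<a$, and put $\mathrm{Lex}_{F,6}(k)=\{w_F(0),\dots,w_F(3^k-1)\}$. Let $\mathrm{maxdim}(F,6)\in\mathbb N\cup\{\infty\}$ be the maximum $k$ such that $\mathrm{Lex}_{F,6}(k)$ is a linear subspace of $\mathbb F_3^{\mathbb N}$ ($\infty$ if there is no maximum). For distinct $\xi,\eta\in\mathbb N$ let $F(\xi,\eta)$ be the basis obtained from $E$ by replacing $e_\xi$ by $e_\xi+e_\eta$.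 For $L\subseteq \mathbb F_3^{\mathbb N}$ let $\mathrm{Res}(L)$ be the code obtained from $L$ by deleting all coordinates $i$ for which $x_i=0$ for every $x\in L$. **Theorem.** Let $F=E$ or $F=F(\xi,\eta)$ for some distinct $\xi,\eta\in\mathbb N$. Then $$\mathrm{maxdim}(F,6)=\begin{cases}6 & \text{if } F=F(\xi,9) \text{ with } 0\le\xi\le 8,\\ 3 & \text{if } F=F(\xi,\eta)\text{ with } 0\le\xi\le 8,\ \eta\ge 10,\\ 2&\text{otherwise.}\end{cases}$$ In particular, if $F=F(\xi,9)$ with $0\le\xi\le 8$, then $\mathrm{Res}(\mathrm{Lex}_{F,6}(6))$ is the extended ternary Golay code (up to equivalence of codes, that is, up to a permutation of the coordinates and multiplication of each coordinate by a nonzero scalar). -/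

import Mathlib

noncomputable section

namespace Lexicode

/-- Finitely supported sequences over `𝔽_p`. -/
abbrev Seq (p : ℕ) : Type := ℕ →₀ ZMod p

/-- Hamming distance: the number of (standard) coordinates in which `x` and `y` differ. -/
def hdist {p : ℕ} (x y : Seq p) : ℕ := (x.neLocus y).card

/-- The order `<_F` induced by an ordered basis `F`: at the largest index `N` at which the
`F`-coordinates of `x` and `y` differ, the coordinate of `x` is the smaller one, where
`𝔽_p` is identified with `{0, 1, …, p - 1}`. -/
def lexLT {p : ℕ} (F : Module.Basis ℕ (ZMod p) (Seq p)) (x y : Seq p) : Prop :=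
  ∃ N : ℕ, (∀ i, N < i → F.repr x i = F.repr y i) ∧ (F.repr x N).val < (F.repr y N).val

theorem lexLT_wf {p : ℕ} (F : Module.Basis ℕ (ZMod p) (Seq p)) : WellFounded (lexLT F) := by
  have h : WellFounded (Finsupp.Lex (fun i j : ℕ => j < i)
      (fun a b : ZMod p => a.val < b.val)) :=
    Finsupp.Lex.wellFounded' (fun n => by simp) (InvImage.wf ZMod.val Nat.lt_wfRel.wf)
      Nat.lt_wfRel.wf
  exact InvImage.wf (fun x => F.repr x) h

/-- There is always a sequence at distance at least `d` from finitely many given ones. -/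
theorem exists_far {p : ℕ} [Fact p.Prime] (d a : ℕ) (w : Fin a → Seq p) :
    {z : Seq p | ∀ b : Fin a, d ≤ hdist z (w b)}.Nonempty := by
  classical
  obtain ⟨M, hM⟩ := (Finset.univ.biUnion fun b : Fin a => (w b).support).exists_nat_subset_range
  refine ⟨Finsupp.indicator (Finset.Ico M (M + d)) fun _ _ => 1, fun b => ?_⟩
  have hsub : Finset.Ico M (M + d) ⊆
      (Finsupp.indicator (Finset.Ico M (M + d)) fun _ _ => (1 : ZMod p)).neLocus (w b) := by
    intro i hi
    have hw : w b i = 0 := by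
      by_contra hne
      have := Finset.mem_range.1 (hM (Finset.mem_biUnion.2
        ⟨b, Finset.mem_univ b, Finsupp.mem_support_iff.2 hne⟩))
      have := (Finset.mem_Ico.1 hi).1
      omega
    rw [Finsupp.mem_neLocus, hw, Finsupp.indicator_of_mem hi]
    exact one_ne_zero
  simpa [hdist] using Finset.card_le_card hsub

/-- The lexicographic sequence: `word F d a` is the minimum, with respect to `<_F`, of all `z`
whose Hamming distance to each of `word F d 0, …, word F d (a - 1)` is at least `d`. -/
def word {p : ℕ} [Fact p.Prime] (F : Module.Basis ℕ (ZMod p) (Seq p)) (d : ℕ) (a : ℕ) : Seq p :=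
  (lexLT_wf F).min {z : Seq p | ∀ b : Fin a, d ≤ hdist z (word F d b)}
    (exists_far d a fun b => word F d b)
termination_by a
decreasing_by all_goals exact b.2

/-- The lexicographic code `{word 0, …, word (p ^ k - 1)}`. -/
def lexCode {p : ℕ} [Fact p.Prime] (F : Module.Basis ℕ (ZMod p) (Seq p)) (d k : ℕ) :
    Set (Seq p) :=
  {x | ∃ a : ℕ, a < p ^ k ∧ x = word F d a}

/-- A code is linear if it is (the underlying set of) a linear subspace. -/
def IsLinearCode {p : ℕ} (L : Set (Seq p)) : Prop :=
  ∃ V : Submodule (ZMod p) (Seq p), (V : Set (Seq p)) = L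

/-- The maximum `k` such that `lexCode F d k` is linear (and `∞` if there is no such maximum). -/
def maxDim {p : ℕ} [Fact p.Prime] (F : Module.Basis ℕ (ZMod p) (Seq p)) (d : ℕ) : ℕ∞ :=
  sSup {m : ℕ∞ | ∃ k : ℕ, m = (k : ℕ∞) ∧ IsLinearCode (lexCode F d k)}

/-- The standard basis `E` of the space of finitely supported sequences. -/
def stdBasis (p : ℕ) : Module.Basis ℕ (ZMod p) (Seq p) := Finsupp.basisSingleOne

/-- The basis `F(ξ, η)`: the standard basis with `e_ξ` replaced by `e_ξ + e_η`
(see `modBasis_apply`), obtained as the image of `E` under `x ↦ x + x_ξ • e_η`. -/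
def modBasis (p ξ η : ℕ) (h : ξ ≠ η) : Module.Basis ℕ (ZMod p) (Seq p) :=
  (stdBasis p).map (LinearEquiv.transvection
    (f := Finsupp.lapply (R := ZMod p) ξ) (v := Finsupp.single η (1 : ZMod p))
    (by simp [h.symm]))

theorem modBasis_apply (p ξ η : ℕ) (h : ξ ≠ η) (i : ℕ) :
    modBasis p ξ η h i =
      if i = ξ then Finsupp.single ξ 1 + Finsupp.single η 1 else Finsupp.single i 1 := by
  change (stdBasis p i : Seq p) + (stdBasis p i : Seq p) ξ • Finsupp.single η (1 : ZMod p) = _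
  by_cases hi : i = ξ
  · simp [stdBasis, hi]
  · simp [stdBasis, hi]

/-- The family consisting of `E` and all the `F(ξ, η)` with `ξ ≠ η`. -/
def basisFamily (p : ℕ) : Set (Module.Basis ℕ (ZMod p) (Seq p)) :=
  {F | F = stdBasis p ∨ ∃ (ξ η : ℕ) (h : ξ ≠ η), F = modBasis p ξ η h}

/-- The support of a code: all standard coordinates at which some codeword is nonzero. -/
def codeSupp {p : ℕ} (L : Set (Seq p)) : Set ℕ := {i | ∃ x ∈ L, x i ≠ 0}

/-- `Res(L)`: the words of `L` with the coordinates outside the support of `L` deleted. -/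
def Res {p : ℕ} (L : Set (Seq p)) : Set (codeSupp L → ZMod p) :=
  (fun (x : Seq p) (i : codeSupp L) => x i) '' L

/-- The standard generator matrix `[I₆ | A]` of the extended ternary Golay code. -/
def golayMatrix : Matrix (Fin 6) (Fin 12) (ZMod 3) :=
  !![1, 0, 0, 0, 0, 0, 0, 1, 1, 1, 1, 1;
     0, 1, 0, 0, 0, 0, 1, 0, 1, 2, 2, 1;
     0, 0, 1, 0, 0, 0, 1, 1, 0, 1, 2, 2;
     0, 0, 0, 1, 0, 0, 1, 2, 1, 0, 1, 2;
     0, 0, 0, 0, 1, 0, 1, 2, 2, 1, 0, 1;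
     0, 0, 0, 0, 0, 1, 1, 1, 2, 2, 1, 0]

/-- The extended ternary Golay code, a `[12, 6, 6]` code: the row space of `golayMatrix`. -/
def extendedTernaryGolay : Submodule (ZMod 3) (Fin 12 → ZMod 3) :=
  Submodule.span (ZMod 3) (Set.range golayMatrix)

/-- A ternary code `C` with coordinates indexed by `ι` is the extended ternary Golay code, as
usual up to equivalence of codes: it becomes that code after a bijective renaming `σ` of the
coordinates by `0, …, 11` and a multiplication of each coordinate by a nonzero scalar. -/
def IsExtendedTernaryGolay {ι : Type*} (C : Set (ι → ZMod 3)) : Prop :=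
  ∃ (σ : ι ≃ Fin 12) (u : Fin 12 → (ZMod 3)ˣ),
    C = {x | (fun j => (u j : ZMod 3) * x (σ.symm j)) ∈ extendedTernaryGolay}

end Lexicode

end

/-! For each basis `F` of the family, let `V` be an explicit code of the claimed dimension `K`.
Three facts give `maxDim F 6 = K`.

(1) `V` is the lexicographic code. It has minimum distance at least 6, its words have
`F`-coordinates below some `n`, and every other word below `n` has a smaller codeword at distance
less than 6. The greedy choice can then never leave `V` before exhausting it
(`lexCode_eq_of_covering`).

(2) The word `v` chosen after `V` is the least word far from `V`. Only words vanishing at the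
leading indices of `V` have to be compared with it (`word_eq_of_covering`).

(3) No later code is linear. If `U` were one, it would contain `V' = V + ⟨v⟩`. Let `z` be a word
outside `V'` that is far from all smaller words of `V'` and has a larger word of `V'` above it. Up
to `z`, the space `U` contains nothing but elements of `V'`, because any other element, reduced
modulo `V'`, would be smaller than `v` and far from `V`. So the greedy choice could not have skipped
`z` (`not_isLinearCode_of_witness`). A single `z` excludes all dimensions above `K`.

These facts concern finitely many `F`-coordinates. The distance for `F(ξ, η)` counts the differing
`F`-coordinates other than `η`, plus one if the sums of coordinates `ξ` and `η` differ. Hence every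
`ξ ≥ 9` behaves like `E`, all `η ≥ 10` behave alike, and finitely many bases remain. For each of
them a certificate `(V, v, z)` is verified by a backtracking search evaluated in the kernel, which
handles all codewords at once by storing one base-64 digit per codeword in a single number
(`search_sound`).

For the Golay statement, a monomial map sends the basis of `V` into the row space of `golayMatrix`,
and counting elements gives equality. -/

namespace Lexicode

/-! ### The order induced by a basis. -/

section Order

variable {p : ℕ} {F : Module.Basis ℕ (ZMod p) (Seq p)}

/-- The `F`-coordinates of `x` with index at least `n` vanish. -/
def Below (F : Module.Basis ℕ (ZMod p) (Seq p)) (n : ℕ) (x : Seq p) : Prop :=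
  ∀ i, n ≤ i → F.repr x i = 0

theorem lexLT_trichotomous [NeZero p] (x y : Seq p) : lexLT F x y ∨ x = y ∨ lexLT F y x := by
  classical
  by_cases hxy : x = y
  · exact Or.inr (Or.inl hxy)
  have hne : (F.repr x).neLocus (F.repr y) ≠ ∅ := by
    simpa using hxy
  have hne := Finset.nonempty_iff_ne_empty.2 hne
  set N := ((F.repr x).neLocus (F.repr y)).max' hne with hN
  have h1 : F.repr x N ≠ F.repr y N := Finsupp.mem_neLocus.1 (Finset.max'_mem _ hne)
  have h2 : ∀ i, N < i → F.repr x i = F.repr y i := by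
    intro i hi
    by_contra h
    exact absurd (Finset.le_max' _ i (Finsupp.mem_neLocus.2 h)) (not_le.2 hi)
  rcases lt_or_gt_of_ne (fun h => h1 (ZMod.val_injective p h)) with h | h
  · exact Or.inl ⟨N, h2, h⟩
  · exact Or.inr (Or.inr ⟨N, fun i hi => (h2 i hi).symm, h⟩)

/-- A nonzero coordinate of `y` at or beyond `n` would make `y` the larger word. This confines the
greedy choice to finitely many coordinates as soon as one eligible word is known. -/
theorem Below.of_lexLT {n : ℕ} {x y : Seq p} (hx : Below F n x) (h : lexLT F y x) :
    Below F n y := by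
  obtain ⟨N, hN, hN'⟩ := h
  have hNn : N < n := by
    by_contra hc
    rw [hx N (not_lt.1 hc)] at hN'
    simp at hN'
  intro i hi
  rw [hN i (hNn.trans_le hi), hx i hi]

theorem Below.of_not_lexLT [NeZero p] {n : ℕ} {x y : Seq p} (hx : Below F n x)
    (h : ¬ lexLT F x y) : Below F n y := by
  rcases lexLT_trichotomous (F := F) x y with h' | rfl | h'
  · exact absurd h' h
  · exact hx
  · exact hx.of_lexLT h'

/-- `v` has `F`-leading index `n` with leading coefficient `1`. -/
def IsLead (F : Module.Basis ℕ (ZMod p) (Seq p)) (v : Seq p) (n : ℕ) : Prop :=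
  F.repr v n = 1 ∧ Below F (n + 1) v

theorem IsLead.sub_lexLT [NeZero p] {v : Seq p} {n : ℕ} (hv : IsLead F v n) {x : Seq p}
    (hx : F.repr x n ≠ 0) : lexLT F (x - F.repr x n • v) x := by
  refine ⟨n, fun i hi => by simp [hv.2 i hi], ?_⟩
  have h : F.repr (x - F.repr x n • v) n = 0 := by simp [hv.1]
  rw [h, ZMod.val_zero]
  exact Nat.pos_of_ne_zero fun h => hx ((ZMod.val_eq_zero _).1 h)

/-- Every coset of a subspace has a least element. -/
theorem exists_min_coset [NeZero p] (F : Module.Basis ℕ (ZMod p) (Seq p))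
    (V : Submodule (ZMod p) (Seq p)) (x : Seq p) :
    ∃ y, x - y ∈ V ∧ ¬ lexLT F x y ∧
      ∀ v n, v ∈ V → IsLead F v n → F.repr y n = 0 := by
  have hne : {y : Seq p | x - y ∈ V}.Nonempty := ⟨x, by simp⟩
  have hmem := (lexLT_wf F).min_mem _ hne
  have hmin : ∀ y ∈ {y : Seq p | x - y ∈ V}, ¬ lexLT F y ((lexLT_wf F).min _ hne) :=
    fun y hy => (lexLT_wf F).not_lt_min _ hy
  refine ⟨(lexLT_wf F).min _ hne, hmem, hmin x (by simp), fun v n hv hl => ?_⟩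
  by_contra h
  refine hmin _ ?_ (hl.sub_lexLT h)
  have : x - (((lexLT_wf F).min _ hne) - F.repr ((lexLT_wf F).min _ hne) n • v)
      = (x - (lexLT_wf F).min _ hne) + F.repr ((lexLT_wf F).min _ hne) n • v := by abel
  rw [Set.mem_ofPred_eq, this]
  exact V.add_mem hmem (V.smul_mem _ hv)

end Order

/-! ### Translation invariance of the Hamming distance. -/

section Distance

variable {p : ℕ}

theorem hdist_comm (x y : Seq p) : hdist x y = hdist y x := by
  rw [hdist, hdist, Finsupp.neLocus_comm]

theorem hdist_sub_right (x y z : Seq p) : hdist (x - z) (y - z) = hdist x y := by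
  simp [hdist]

theorem hdist_eq_sub (x y : Seq p) : hdist x y = hdist (x - y) 0 := by
  rw [← hdist_sub_right x y y, sub_self]

theorem hdist_self (x : Seq p) : hdist x x = 0 := by
  simp [hdist]

end Distance

/-! ### Criteria for greedy codes: identification, next word, failure of linearity. -/

section Words

variable {p : ℕ} [Fact p.Prime] {F : Module.Basis ℕ (ZMod p) (Seq p)} {d : ℕ}

theorem le_hdist_word {a b : ℕ} (h : b < a) : d ≤ hdist (word F d a) (word F d b) := by
  have := (lexLT_wf F).min_mem {z : Seq p | ∀ b : Fin a, d ≤ hdist z (word F d b)}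
    (exists_far d a fun b => word F d b)
  rw [word]
  exact this ⟨b, h⟩

theorem le_hdist_word_of_ne {a b : ℕ} (h : a ≠ b) : d ≤ hdist (word F d a) (word F d b) := by
  rcases lt_or_gt_of_ne h with h | h
  · rw [hdist_comm]; exact le_hdist_word h
  · exact le_hdist_word h

theorem not_lexLT_word {a : ℕ} {z : Seq p} (hz : ∀ b < a, d ≤ hdist z (word F d b)) :
    ¬ lexLT F z (word F d a) := by
  rw [word]
  have h : z ∈ {z : Seq p | ∀ b : Fin a, d ≤ hdist z (word F d b)} := fun b => hz b b.2
  exact (lexLT_wf F).not_lt_min _ h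

theorem word_injective (hd : 0 < d) : Function.Injective (word F d) := by
  intro a b hab
  by_contra h
  have := le_hdist_word_of_ne (F := F) (d := d) h
  rw [hab, hdist_self] at this
  omega

theorem exists_notMem_words (V : Set (Seq p)) {m a : ℕ} (hm : V.ncard = m) (ha : a < m)
    (w : ℕ → Seq p) : ∃ x ∈ V, ∀ b < a, x ≠ w b := by
  classical
  have hfin : V.Finite := Set.finite_of_ncard_ne_zero (by omega)
  by_contra! h
  have hsub : V ⊆ ((Finset.range a).image w : Finset (Seq p)) := by
    intro x hx
    obtain ⟨b, hb, rfl⟩ := h x hx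
    simpa using ⟨b, hb, rfl⟩
  have := Set.ncard_le_ncard hsub (Finset.finite_toSet _)
  rw [Set.ncard_coe_finset] at this
  have := Finset.card_image_le (s := Finset.range a) (f := w)
  simp at this
  omega

theorem lexCode_eq_image (k : ℕ) :
    lexCode F d k = word F d '' (Finset.range (p ^ k) : Finset ℕ) := by
  ext x
  simp [lexCode, eq_comm]

theorem ncard_lexCode (hd : 0 < d) (k : ℕ) : (lexCode F d k).ncard = p ^ k := by
  rw [lexCode_eq_image, Set.ncard_image_of_injective _ (word_injective hd), Set.ncard_coe_finset,
    Finset.card_range]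

theorem word_mem_lexCode {a k : ℕ} (h : a < p ^ k) : word F d a ∈ lexCode F d k := ⟨a, h, rfl⟩

/-- A criterion for a set of words to be a lexicographic code. -/
theorem lexCode_eq_of_covering (hd : 0 < d) {V : Set (Seq p)} {k n : ℕ}
    (hcard : V.ncard = p ^ k) (hdist : ∀ x ∈ V, ∀ y ∈ V, x ≠ y → d ≤ hdist x y)
    (hbelow : ∀ x ∈ V, Below F n x)
    (hcov : ∀ z, Below F n z → z ∉ V → ∃ c ∈ V, lexLT F c z ∧ Lexicode.hdist z c < d) :
    lexCode F d k = V := by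
  have hfin : V.Finite := Set.finite_of_ncard_ne_zero (by
    rw [hcard]; exact pow_ne_zero _ (Fact.out : p.Prime).ne_zero)
  have key : ∀ a, a < p ^ k → word F d a ∈ V := by
    intro a
    induction a using Nat.strong_induction_on with
    | _ a ih =>
      intro ha
      have far : ∀ x ∈ V, (∀ b < a, x ≠ word F d b) → ¬ lexLT F x (word F d a) :=
        fun x hx hxb => not_lexLT_word fun b hb =>
          hdist x hx _ (ih b hb (hb.trans ha)) (hxb b hb)
      -- Fewer words than `V` has elements have been chosen, so some codeword is still eligible. By
      -- minimality the new word does not exceed it and so stays below `n`.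
      obtain ⟨x, hx, hxb⟩ := exists_notMem_words V hcard ha (word F d)
      by_contra hmem
      obtain ⟨c, hc, hlt, hcd⟩ := hcov _ ((hbelow x hx).of_not_lexLT (far x hx hxb)) hmem
      -- The codeword `c` is too close to the new word to be an earlier word, hence it was eligible
      -- and smaller.
      refine far c hc (fun b hb hcb => ?_) hlt
      have := le_hdist_word (F := F) (d := d) hb
      rw [← hcb] at this
      omega
  refine Set.eq_of_subset_of_ncard_le ?_ ?_ hfin
  · rintro x ⟨a, ha, rfl⟩
    exact key a ha
  · rw [hcard, ncard_lexCode hd]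

/-- Identification of the first word after a lexicographic code that is a subspace. -/
theorem word_eq_of_covering {V : Submodule (ZMod p) (Seq p)} {k n : ℕ} {v : Seq p}
    (hV : lexCode F d k = V) (hv : ∀ c ∈ V, d ≤ hdist v c) (hbelow : Below F n v)
    (hcov : ∀ z, Below F n z → (∀ u m, u ∈ V → IsLead F u m → F.repr z m = 0) →
      (∀ c ∈ V, d ≤ hdist z c) → z = v ∨ lexLT F v z) :
    word F d (p ^ k) = v := by
  have hw : ∀ c ∈ V, d ≤ hdist (word F d (p ^ k)) c := by
    intro c hc
    rw [← SetLike.mem_coe, ← hV] at hc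
    obtain ⟨b, hb, rfl⟩ := hc
    exact le_hdist_word hb
  have hmin : ∀ z, (∀ c ∈ V, d ≤ hdist z c) → ¬ lexLT F z (word F d (p ^ k)) := by
    intro z hz
    refine not_lexLT_word fun b hb => hz _ ?_
    rw [← SetLike.mem_coe, ← hV]
    exact word_mem_lexCode hb
  -- Subtracting a multiple of `u ∈ V` only permutes the distances to `V`, so a nonzero coordinate
  -- at a leading index would yield a smaller eligible word.
  have hred : ∀ u m, u ∈ V → IsLead F u m → F.repr (word F d (p ^ k)) m = 0 := by
    intro u m hu hl
    by_contra h
    refine hmin _ (fun c hc => ?_) (hl.sub_lexLT h)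
    have := hw (c + F.repr (word F d (p ^ k)) m • u) (V.add_mem hc (V.smul_mem _ hu))
    rw [hdist_eq_sub] at this ⊢
    convert this using 2
    abel
  rcases hcov _ (hbelow.of_not_lexLT (hmin v hv)) hred hw with h | h
  · exact h
  · exact absurd h (hmin v hv)

/-- A criterion for the larger lexicographic codes not to be linear. -/
theorem not_isLinearCode_of_witness {V V' : Submodule (ZMod p) (Seq p)} {k n : ℕ}
    {v z : Seq p} (hV : lexCode F d k = V) (hw : word F d (p ^ k) = v) (hlead : IsLead F v n)
    (hV' : V' = V ⊔ Submodule.span (ZMod p) {v}) (hz : z ∉ V') (hzn : Below F (n + 1) z)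
    (hfar : ∀ c ∈ V', lexLT F c z → d ≤ hdist z c) (hbig : ∃ c ∈ V', lexLT F z c)
    {m : ℕ} (hm : k < m) : ¬ IsLinearCode (lexCode F d m) := by
  rintro ⟨U, hU⟩
  have hpk : p ^ k < p ^ m := Nat.pow_lt_pow_right (Fact.out : p.Prime).one_lt hm
  have hVV' : V ≤ V' := hV' ▸ le_sup_left
  have hvV' : v ∈ V' := hV' ▸ (le_sup_right : _ ≤ V ⊔ _) (Submodule.mem_span_singleton_self v)
  have hVU : V ≤ U := by
    intro x hx
    rw [← SetLike.mem_coe, ← hV] at hx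
    obtain ⟨a, ha, rfl⟩ := hx
    rw [← SetLike.mem_coe, hU]
    exact word_mem_lexCode (ha.trans hpk)
  have hvU : v ∈ U := by
    rw [← SetLike.mem_coe, hU, ← hw]
    exact word_mem_lexCode hpk
  have hV'U : V' ≤ U := by
    rw [hV', sup_le_iff, Submodule.span_singleton_le_iff_mem]
    exact ⟨hVU, hvU⟩
  have hUd : ∀ x ∈ U, ∀ y ∈ U, x ≠ y → d ≤ hdist x y := by
    intro x hx y hy hxy
    rw [← SetLike.mem_coe, hU] at hx hy
    obtain ⟨a, _, rfl⟩ := hx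
    obtain ⟨b, _, rfl⟩ := hy
    exact le_hdist_word_of_ne fun h => hxy (by rw [h])
  -- Elements of `U` not exceeding `z` lie in `V'`: otherwise the reduction of such an element
  -- modulo `V'` is a nonzero class that should have been chosen before `v`.
  have hseg : ∀ u ∈ U, ¬ lexLT F z u → u ∈ V' := by
    intro u hu hzu
    obtain ⟨y, hy, hyu, hlead0⟩ := exists_min_coset F V' u
    by_contra huV'
    have hyU : y ∈ U := by
      have := U.sub_mem hu (hV'U hy)
      rwa [sub_sub_cancel] at this
    have hyV' : y ∉ V' := fun h => huV' (by simpa using V'.add_mem hy h)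
    have hyb : Below F (n + 1) y := (hzn.of_not_lexLT hzu).of_not_lexLT hyu
    have hyn : F.repr y n = 0 := hlead0 v n hvV' hlead
    -- Both words vanish beyond `n`, and at `n` the coordinate is `0` for `y`, by reduction against
    -- `v`, but `1` for `v`.
    have hlt : lexLT F y v := by
      refine ⟨n, fun i hi => by rw [hyb i hi, hlead.2 i hi], ?_⟩
      have : Fact (1 < p) := ⟨(Fact.out : p.Prime).one_lt⟩
      rw [hyn, hlead.1, ZMod.val_zero, ZMod.val_one]
      exact one_pos
    rw [← hw] at hlt
    refine not_lexLT_word (fun b hb => ?_) hlt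
    have hb' : word F d b ∈ V := by
      rw [← SetLike.mem_coe, ← hV]
      exact word_mem_lexCode hb
    exact hUd y hyU _ (hVU hb') fun h => hyV' (h ▸ hVV' hb')
  obtain ⟨c, hc, hzc⟩ := hbig
  -- At the first word exceeding `z`, all previous words lie in `V'` and are smaller than `z`, hence
  -- far from it. So `z` was eligible and should have been preferred.
  have hex : ∃ a, a < p ^ m ∧ lexLT F z (word F d a) := by
    have := hV'U hc
    rw [← SetLike.mem_coe, hU] at this
    obtain ⟨a, ha, rfl⟩ := this
    exact ⟨a, ha, hzc⟩
  classical
  obtain ⟨ha, hlt⟩ := Nat.find_spec hex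
  refine not_lexLT_word (fun b hb => ?_) hlt
  have hbU : word F d b ∈ U := by
    rw [← SetLike.mem_coe, hU]
    exact word_mem_lexCode (hb.trans ha)
  have hzb : ¬ lexLT F z (word F d b) := fun h => Nat.find_min hex hb ⟨hb.trans ha, h⟩
  have hbV' := hseg _ hbU hzb
  refine hfar _ hbV' ?_
  rcases lexLT_trichotomous (F := F) (word F d b) z with h | h | h
  · exact h
  · exact absurd (h ▸ hbV') hz
  · exact absurd h hzb

theorem maxDim_eq {K : ℕ} (h : IsLinearCode (lexCode F d K))
    (h' : ∀ m, K < m → ¬ IsLinearCode (lexCode F d m)) : maxDim F d = K := by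
  refine le_antisymm (sSup_le ?_) (le_sSup ⟨K, rfl, h⟩)
  rintro _ ⟨k, rfl, hk⟩
  by_contra hlt
  exact h' k (by simpa using hlt) hk

end Words


/-! ### Arithmetic on base-64 digits in parallel. -/

section Pack

/-- The number with base-`64` digits `l`. -/
def pack : List ℕ → ℕ
  | [] => 0
  | x :: l => x + 64 * pack l

open Classical in
/-- The indicator of a proposition. -/
noncomputable def ind (P : Prop) : ℕ := if P then 1 else 0

theorem ind_le_one (P : Prop) : ind P ≤ 1 := by
  unfold ind; split_ifs <;> simp

theorem ind_pos {P : Prop} (h : P) : ind P = 1 := by simp [ind, h]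

theorem ind_neg {P : Prop} (h : ¬ P) : ind P = 0 := by simp [ind, h]

variable {α : Type*}

theorem pack_append (l l' : List ℕ) : pack (l ++ l') = pack l + 64 ^ l.length * pack l' := by
  induction l with
  | nil => simp [pack]
  | cons x l ih => simp only [List.cons_append, pack, ih, List.length_cons]; ring

theorem pack_map_add (W : List α) (f g : α → ℕ) :
    pack (W.map f) + pack (W.map g) = pack (W.map fun e => f e + g e) := by
  induction W with
  | nil => rfl
  | cons x W ih => simp only [List.map_cons, pack, ← ih]; ring

theorem mul_pack_map (W : List α) (k : ℕ) (f : α → ℕ) :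
    k * pack (W.map f) = pack (W.map fun e => k * f e) := by
  induction W with
  | nil => rfl
  | cons x W ih => simp only [List.map_cons, pack, ← ih]; ring

theorem pack_map_zero (W : List α) : pack (W.map fun _ => 0) = 0 := by
  induction W with
  | nil => rfl
  | cons x W ih => simp only [List.map_cons, pack, ih]

theorem pack_map_congr {W : List α} {f g : α → ℕ} (h : ∀ e ∈ W, f e = g e) :
    pack (W.map f) = pack (W.map g) := by
  rw [List.map_congr_left h]

theorem testBit_add_mul (x X i : ℕ) (hx : x < 64) :
    (x + 64 * X).testBit i = if i < 6 then x.testBit i else X.testBit (i - 6) := by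
  have := Nat.testBit_two_pow_mul_add X (b := x) (i := 6) (by simpa using hx) i
  rw [add_comm]
  simpa using this

/-- A base-64 digit occupies exactly six bits, so bitwise operations act digit by digit. -/
theorem land_add_mul {x y : ℕ} (X Y : ℕ) (hx : x < 64) (hy : y < 64) :
    Nat.land (x + 64 * X) (y + 64 * Y) = Nat.land x y + 64 * Nat.land X Y := by
  refine Nat.eq_of_testBit_eq fun i => ?_
  have hxy : Nat.land x y < 64 := lt_of_le_of_lt Nat.and_le_left hx
  rw [testBit_add_mul _ _ _ hxy]
  change ((x + 64 * X) &&& (y + 64 * Y)).testBit i =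
    if i < 6 then (x &&& y).testBit i else (X &&& Y).testBit (i - 6)
  rw [Nat.testBit_and, testBit_add_mul _ _ _ hx, testBit_add_mul _ _ _ hy]
  split_ifs <;> simp

theorem lor_add_mul {x y : ℕ} (X Y : ℕ) (hx : x < 64) (hy : y < 64) :
    Nat.lor (x + 64 * X) (y + 64 * Y) = Nat.lor x y + 64 * Nat.lor X Y := by
  refine Nat.eq_of_testBit_eq fun i => ?_
  have hxy : Nat.lor x y < 64 := Nat.or_lt_two_pow (n := 6) hx hy
  rw [testBit_add_mul _ _ _ hxy]
  change ((x + 64 * X) ||| (y + 64 * Y)).testBit i =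
    if i < 6 then (x ||| y).testBit i else (X ||| Y).testBit (i - 6)
  rw [Nat.testBit_or, testBit_add_mul _ _ _ hx, testBit_add_mul _ _ _ hy]
  split_ifs <;> simp

theorem land_flag_lt (m : ℕ) (hm : m < 64) : Nat.land 32 m = if 32 ≤ m then 32 else 0 := by
  decide +revert

/-- The top bit of a six-bit digit is the comparison with 32. One bitwise operation therefore
compares all flagged digits with 32 simultaneously. -/
theorem land_pack_flag (W : List α) (P : α → Prop) {m : α → ℕ} (hm : ∀ e ∈ W, m e < 64) :
    Nat.land (pack (W.map fun e => 32 * ind (P e))) (pack (W.map m)) =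
      pack (W.map fun e => 32 * ind (P e ∧ 32 ≤ m e)) := by
  induction W with
  | nil => exact Nat.zero_and 0
  | cons x W ih =>
    have hx : m x < 64 := hm x (by simp)
    simp only [List.map_cons, pack]
    rw [land_add_mul _ _ (by have := ind_le_one (P x); omega) hx,
      ih fun e he => hm e (List.mem_cons_of_mem _ he)]
    congr 1
    by_cases hP : P x
    · rw [ind_pos hP, mul_one, land_flag_lt _ hx]
      split_ifs with h
      · rw [ind_pos ⟨hP, h⟩]
      · rw [ind_neg fun h' => h h'.2]
    · rw [ind_neg hP, ind_neg fun h => hP h.1]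
      simp [Nat.land_eq]

theorem land_pack_flags (W : List α) (P Q : α → Prop) :
    Nat.land (pack (W.map fun e => 32 * ind (P e))) (pack (W.map fun e => 32 * ind (Q e))) =
      pack (W.map fun e => 32 * ind (P e ∧ Q e)) := by
  rw [land_pack_flag W P fun e _ => by have := ind_le_one (Q e); omega]
  refine pack_map_congr fun e _ => ?_
  by_cases hQ : Q e
  · rw [ind_pos hQ]
    simp [hQ]
  · rw [ind_neg hQ]
    simp [hQ]

theorem lor_pack_flags (W : List α) (P Q : α → Prop) :
    Nat.lor (pack (W.map fun e => 32 * ind (P e))) (pack (W.map fun e => 32 * ind (Q e))) =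
      pack (W.map fun e => 32 * ind (P e ∨ Q e)) := by
  induction W with
  | nil => exact Nat.zero_or 0
  | cons x W ih =>
    simp only [List.map_cons, pack]
    rw [lor_add_mul _ _ (by have := ind_le_one (P x); omega)
      (by have := ind_le_one (Q x); omega), ih]
    congr 1
    by_cases hP : P x <;> by_cases hQ : Q x <;> simp [ind, hP, hQ]

theorem eq_of_pack_map_eq {W : List α} {f g : α → ℕ} (hf : ∀ e ∈ W, f e < 64)
    (hg : ∀ e ∈ W, g e < 64) (h : pack (W.map f) = pack (W.map g)) : ∀ e ∈ W, f e = g e := by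
  induction W with
  | nil => simp
  | cons x W ih =>
    simp only [List.map_cons, pack] at h
    have hfx := hf x (by simp)
    have hgx := hg x (by simp)
    intro e he
    rcases List.mem_cons.1 he with rfl | he
    · omega
    · exact ih (fun e he => hf e (List.mem_cons_of_mem _ he))
        (fun e he => hg e (List.mem_cons_of_mem _ he)) (by omega) e he

theorem flags_eq_iff (W : List α) (P Q : α → Prop) :
    pack (W.map fun e => 32 * ind (P e)) = pack (W.map fun e => 32 * ind (Q e)) ↔
      ∀ e ∈ W, (P e ↔ Q e) := by
  constructor
  · intro h e he
    have := eq_of_pack_map_eq (fun e _ => by have := ind_le_one (P e); omega)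
      (fun e _ => by have := ind_le_one (Q e); omega) h e he
    by_cases hP : P e <;> by_cases hQ : Q e <;> simp_all [ind]
  · intro h
    refine pack_map_congr fun e he => ?_
    rw [propext (h e he)]

theorem land_flags_eq_self_iff (W : List α) (P : α → Prop) {m : α → ℕ}
    (hm : ∀ e ∈ W, m e < 64) :
    Nat.beq (Nat.land (pack (W.map fun e => 32 * ind (P e))) (pack (W.map m)))
      (pack (W.map fun e => 32 * ind (P e))) = true ↔ ∀ e ∈ W, P e → 32 ≤ m e := by
  rw [Nat.beq_eq, land_pack_flag W P hm, flags_eq_iff]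
  refine forall₂_congr fun e _ => ?_
  tauto

theorem flags_eq_zero_iff (W : List α) (P : α → Prop) :
    Nat.beq (pack (W.map fun e => 32 * ind (P e))) 0 = true ↔ ∀ e ∈ W, ¬ P e := by
  have h := flags_eq_iff W P fun _ => False
  have h0 : pack (W.map fun _ => 32 * ind False) = 0 := by
    simpa [ind] using pack_map_zero W
  rw [h0] at h
  rw [Nat.beq_eq, h]
  simp

end Pack

/-! ### Backtracking search over words, from the highest coordinate down. -/

section Search

/-! The definitions executed by the kernel are written with recursors, which it evaluates fast. -/

/-- Forces the evaluation of a number by the kernel before it is passed on. -/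
noncomputable def force {α : Type} (n : ℕ) (f : ℕ → α) : α :=
  Nat.rec (f 0) (fun m _ => f (Nat.succ m)) n

theorem force_eq {α : Type} (n : ℕ) (f : ℕ → α) : force n f = f n := by
  cases n <;> rfl

/-- The effect of choosing one more coordinate: `A` is added to the packed distances, `L` and `E`
flag the words whose coordinate is smaller, respectively equal, and `t` is the new memory. -/
structure Move where
  A : ℕ
  L : ℕ
  E : ℕ
  t : ℕ

/-- One step of the search. -/
noncomputable def Move.apply {α : Type} (m : Move) (D P Q : ℕ) (k : ℕ → ℕ → ℕ → ℕ → α) : α :=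
  force (Nat.add D m.A) fun D' => force (Nat.lor P (Nat.land Q m.L)) fun P' =>
    force (Nat.land Q m.E) fun Q' => force m.t fun t' => k D' P' Q' t'

/-- Exhaustive search over all choices of the coordinates below `r` (only `0` is chosen where `dg`
is true), abandoning a branch as soon as some flagged word stays close for every choice of the
remaining coordinates. -/
noncomputable def search (K : ℕ → ℕ) (dg : ℕ → Bool) (mv : ℕ → ℕ → ℕ → Move) (r : ℕ) :
    ℕ → ℕ → ℕ → ℕ → Bool :=
  Nat.rec
    (fun D P Q _ =>
      -- `Bool.rec` takes the value for `false` first. A leaf succeeds if some word flagged in `P`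
      -- has a digit below 32, or if `Q` still flags a word that agrees with the branch everywhere.
      Bool.rec true (Bool.rec true false (Nat.beq Q 0)) (Nat.beq (Nat.land P D) P))
    (fun r ih D P Q t =>
      Bool.rec true
        (Bool.rec false
          (Bool.rec
            (Bool.rec false ((mv r t 2).apply D P Q ih) ((mv r t 1).apply D P Q ih))
            true (dg r))
          ((mv r t 0).apply D P Q ih))
        (Nat.beq (Nat.land P (Nat.add D (K r))) P)) r

theorem search_zero {K : ℕ → ℕ} {dg : ℕ → Bool} {mv : ℕ → ℕ → ℕ → Move} {D P Q t : ℕ}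
    (h : search K dg mv 0 D P Q t = true) (h1 : Nat.beq (Nat.land P D) P = true) :
    Nat.beq Q 0 = false := by
  change Bool.rec true (Bool.rec true false (Nat.beq Q 0)) (Nat.beq (Nat.land P D) P) = true at h
  rw [h1] at h
  by_contra hQ
  rw [Bool.not_eq_false] at hQ
  rw [hQ] at h
  exact absurd h (by simp)

theorem search_succ {K : ℕ → ℕ} {dg : ℕ → Bool} {mv : ℕ → ℕ → ℕ → Move} {r D P Q t : ℕ}
    (h : search K dg mv (r + 1) D P Q t = true)
    (h1 : Nat.beq (Nat.land P (Nat.add D (K r))) P = true) {a : ℕ} (ha : a < 3)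
    (hdg : dg r = true → a = 0) : (mv r t a).apply D P Q (search K dg mv r) = true := by
  change Bool.rec true (Bool.rec false
    (Bool.rec (Bool.rec false ((mv r t 2).apply D P Q (search K dg mv r))
      ((mv r t 1).apply D P Q (search K dg mv r))) true (dg r))
    ((mv r t 0).apply D P Q (search K dg mv r))) (Nat.beq (Nat.land P (Nat.add D (K r))) P) = true
    at h
  rw [h1] at h
  cases h0 : (mv r t 0).apply D P Q (search K dg mv r) with
  | false => simp [h0] at h
  | true =>
    cases hd : dg r with
    | true => rw [hdg hd, h0]
    | false =>
      cases h1 : (mv r t 1).apply D P Q (search K dg mv r) with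
      | false => simp [h0, hd, h1] at h
      | true =>
        simp only [h0, hd, h1] at h
        interval_cases a <;> assumption

/-- The final state of the search along the branch with coordinates `z`. -/
noncomputable def follow {α : Type} (mv : ℕ → ℕ → ℕ → Move) (z : ℕ → ℕ) (k : ℕ → ℕ → ℕ → α)
    (r : ℕ) : ℕ → ℕ → ℕ → ℕ → α :=
  Nat.rec (fun D P Q _ => k D P Q) (fun r ih D P Q t => (mv r t (z r)).apply D P Q ih) r

theorem follow_succ {α : Type} {mv : ℕ → ℕ → ℕ → Move} {z : ℕ → ℕ} {k : ℕ → ℕ → ℕ → α}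
    {r D P Q t : ℕ} : follow mv z k (r + 1) D P Q t =
      (mv r t (z r)).apply D P Q (follow mv z k r) := rfl

/-- A word together with the initial state of the search concerning it. -/
structure Entry where
  w : Seq 3
  init : ℕ
  p : Prop
  q : Prop

/-- The words agree from index `r` on. -/
def EqFrom (r : ℕ) (c z : Seq 3) : Prop := ∀ i, r ≤ i → c i = z i

/-- At the last index where they differ, which is at least `r`, the word `c` is smaller. -/
def LtFrom (r : ℕ) (c z : Seq 3) : Prop :=
  ∃ M, r ≤ M ∧ (∀ i, M < i → c i = z i) ∧ (c M).val < (z M).val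

theorem eqFrom_iff (r : ℕ) (c z : Seq 3) : EqFrom r c z ↔ EqFrom (r + 1) c z ∧ c r = z r := by
  refine ⟨fun h => ⟨fun i hi => h i (by omega), h r le_rfl⟩, fun h i hi => ?_⟩
  rcases hi.eq_or_lt with rfl | hi
  · exact h.2
  · exact h.1 i hi

theorem ltFrom_iff (r : ℕ) (c z : Seq 3) :
    LtFrom r c z ↔ LtFrom (r + 1) c z ∨ (EqFrom (r + 1) c z ∧ (c r).val < (z r).val) := by
  constructor
  · rintro ⟨M, hr, h1, h2⟩
    rcases hr.eq_or_lt with rfl | hr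
    · exact Or.inr ⟨fun i hi => h1 i hi, h2⟩
    · exact Or.inl ⟨M, hr, h1, h2⟩
  · rintro (⟨M, hr, h1, h2⟩ | ⟨h1, h2⟩)
    · exact ⟨M, by omega, h1, h2⟩
    · exact ⟨r, le_rfl, fun i hi => h1 i hi, h2⟩

variable (N ξ η : ℕ)

/-- The contribution to the distance that is known once the coordinates from `i` on are. -/
noncomputable def stepCost (i : ℕ) (c z : Seq 3) : ℕ :=
  -- The standard coordinate with index `η` is the sum of the `F`-coordinates `ξ` and `η`. It is
  -- charged at the smaller of the two indices, where both are known in a descending search.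
  ind (i ≠ η ∧ c i ≠ z i) + ind (i = min ξ η ∧ c ξ + c η ≠ z ξ + z η)

/-- The part of the distance that is known once the coordinates from `r` on are. -/
noncomputable def costFrom (r : ℕ) (c z : Seq 3) : ℕ := ∑ i ∈ Finset.Ico r N, stepCost ξ η i c z

/-- The maximal contribution to the distance of the coordinates below `r`. -/
def capacity (ξ η : ℕ) : ℕ → ℕ
  | 0 => 0
  | r + 1 => capacity ξ η r + ((bif Nat.beq r η then 0 else 1) +
      (bif Nat.beq r (min ξ η) then 1 else 0))

theorem stepCost_le (i : ℕ) (c z : Seq 3) : capacity ξ η i + stepCost ξ η i c z ≤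
    capacity ξ η (i + 1) := by
  have h : stepCost ξ η i c z ≤ (bif Nat.beq i η then 0 else 1) +
      (bif Nat.beq i (min ξ η) then 1 else 0) := by
    unfold stepCost
    refine add_le_add ?_ ?_
    · by_cases h : i = η
      · rw [ind_neg (by tauto)]; exact Nat.zero_le _
      · have : Nat.beq i η = false := by simpa [← Nat.beq_eq] using h
        rw [this]; exact ind_le_one _
    · by_cases h : i = min ξ η
      · have : Nat.beq i (min ξ η) = true := by rwa [Nat.beq_eq]
        rw [this]; exact ind_le_one _
      · rw [ind_neg (by tauto)]; exact Nat.zero_le _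
  rw [capacity]
  omega

variable {N ξ η}

theorem costFrom_succ {r : ℕ} (hr : r < N) (c z : Seq 3) :
    costFrom N ξ η r c z = costFrom N ξ η (r + 1) c z + stepCost ξ η r c z := by
  rw [costFrom, Finset.sum_eq_sum_Ico_succ_bot hr, add_comm]; rfl

/-- The cost already paid and the cost still possible never exceed the total capacity. This bounds
the digits and rules out carries between them. -/
theorem capacity_add_costFrom_le {r : ℕ} (hr : r ≤ N) (c z : Seq 3) :
    capacity ξ η r + costFrom N ξ η r c z ≤ capacity ξ η N := by
  induction hr using Nat.decreasingInduction with
  | self => simp [costFrom]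
  | of_succ r hr ih =>
    have := stepCost_le ξ η r c z
    rw [costFrom_succ hr]
    omega

/-- Justifies abandoning a branch: a word that would be close even if it differed in all remaining
coordinates is close for every continuation. -/
theorem costFrom_zero_le {r : ℕ} (hr : r ≤ N) (c z : Seq 3) :
    costFrom N ξ η 0 c z ≤ costFrom N ξ η r c z + capacity ξ η r := by
  induction r with
  | zero => omega
  | succ r ih =>
    have h1 := ih (by omega)
    have h2 := stepCost_le ξ η r c z
    rw [costFrom_succ (show r < N by omega)] at h1
    omega

/-- The moves describe the list `W` of words. -/
def MoveSpec (N ξ η : ℕ) (W : List Entry) (mv : ℕ → ℕ → ℕ → Move) : Prop :=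
  ∀ r t a, r < N → t < 3 → a < 3 → mv r t a =
    ⟨pack (W.map fun e => ind (r ≠ η ∧ e.w r ≠ (a : ZMod 3)) +
        ind (r = min ξ η ∧ e.w ξ + e.w η ≠ (a : ZMod 3) + t)),
      pack (W.map fun e => 32 * ind ((e.w r).val < a)),
      pack (W.map fun e => 32 * ind (e.w r = (a : ZMod 3))),
      if r = max ξ η then a else t⟩

/-- The state of the search once the coordinates from `r` on are those of `z`. -/
structure State (N ξ η : ℕ) (W : List Entry) (z : Seq 3) (r D P Q t : ℕ) : Prop where
  dist : D = pack (W.map fun e => e.init + costFrom N ξ η r e.w z)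
  lt : P = pack (W.map fun e => 32 * ind (e.p ∨ (e.q ∧ LtFrom r e.w z)))
  eq : Q = pack (W.map fun e => 32 * ind (e.q ∧ EqFrom r e.w z))
  -- The default `0` never enters a cost: since `ξ ≠ η`, the larger index has been passed when the
  -- memory is read at the smaller one.
  mem : t = if r ≤ max ξ η then (z (max ξ η)).val else 0

variable {W : List Entry} {mv : ℕ → ℕ → ℕ → Move} {z : Seq 3}

theorem State.apply (hξη : ξ ≠ η) (hmv : MoveSpec N ξ η W mv) {r D P Q t : ℕ} (hr : r < N)
    (h : State N ξ η W z (r + 1) D P Q t) {α : Type} (k : ℕ → ℕ → ℕ → ℕ → α) :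
    ∃ D' P' Q' t', (mv r t (z r).val).apply D P Q k = k D' P' Q' t' ∧
      State N ξ η W z r D' P' Q' t' := by
  obtain ⟨rfl, rfl, rfl, ht⟩ := h
  have ht3 : t < 3 := by
    rw [ht]; split_ifs
    · exact ZMod.val_lt _
    · norm_num
  simp only [Move.apply, force_eq, hmv r t _ hr ht3 (ZMod.val_lt _)]
  refine ⟨_, _, _, _, rfl, ?_, ?_, ?_, ?_⟩
  · rw [Nat.add_eq, pack_map_add]
    refine pack_map_congr fun e _ => ?_
    rw [costFrom_succ hr, stepCost, add_assoc]
    congr 3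
    · simp
    · congr 1
      refine propext (and_congr_right fun hm => ?_)
      -- Here `r` is the smaller of `ξ` and `η`, and the memory holds the coordinate at the larger
      -- one.
      have : ((z r).val : ZMod 3) + (t : ZMod 3) = z ξ + z η := by
        have hle : r + 1 ≤ max ξ η := by omega
        rw [ht, if_pos hle]
        rcases le_total ξ η with h | h
        · rw [min_eq_left h] at hm
          rw [max_eq_right h, hm]
          simp
        · rw [min_eq_right h] at hm
          rw [max_eq_left h, hm, add_comm]
          simp
      rw [this]
  · rw [land_pack_flags, lor_pack_flags]
    refine pack_map_congr fun e _ => ?_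
    rw [ltFrom_iff r]
    congr 2
    refine propext ?_
    tauto
  · rw [land_pack_flags]
    refine pack_map_congr fun e _ => ?_
    rw [eqFrom_iff r, and_assoc]
    simp
  · by_cases h : r = max ξ η
    · rw [if_pos h, if_pos h.le, ← h]
    · rw [if_neg h, ht]
      congr 1
      refine propext ?_
      omega

/-- Descend along the branch prescribed by `z`. If it is abandoned, the flagged word responsible
stays below 32 for every continuation, in particular for `z`. If it reaches a leaf, the success of
the leaf gives a close flagged word or a word equal to `z`. -/
theorem search_sound (hξη : ξ ≠ η) (hmv : MoveSpec N ξ η W mv) {K : ℕ → ℕ} {dg : ℕ → Bool}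
    (hK : ∀ r, K r = pack (W.map fun _ => capacity ξ η (r + 1)))
    (hcap : ∀ e ∈ W, e.init + capacity ξ η N < 64) {r : ℕ} (hr : r ≤ N) {D P Q t : ℕ}
    (hz : ∀ i, i < r → dg i = true → z i = 0) (hs : State N ξ η W z r D P Q t)
    (h : search K dg mv r D P Q t = true) :
    ∃ e ∈ W, (e.init + costFrom N ξ η 0 e.w z < 32 ∧ (e.p ∨ (e.q ∧ LtFrom 0 e.w z))) ∨
      (e.q ∧ EqFrom 0 e.w z) := by
  induction r generalizing D P Q t with
  | zero =>
    obtain ⟨rfl, rfl, rfl, -⟩ := hs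
    by_contra! hcon
    have hlt : ∀ e ∈ W, e.init + costFrom N ξ η 0 e.w z < 64 := by
      intro e he
      have := hcap e he
      have := capacity_add_costFrom_le (ξ := ξ) (η := η) (Nat.zero_le N) e.w z
      omega
    have h1 := (land_flags_eq_self_iff W (fun e => e.p ∨ e.q ∧ LtFrom 0 e.w z) hlt).2
      fun e he hp => by
        by_contra hd
        have := (hcon e he).1 (by omega)
        tauto
    have h2 := (flags_eq_zero_iff W fun e => e.q ∧ EqFrom 0 e.w z).2
      fun e he hq => (hcon e he).2 hq.1 hq.2
    rw [search_zero h h1] at h2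
    exact absurd h2 (by simp)
  | succ r ih =>
    by_cases hb : Nat.beq (Nat.land P (Nat.add D (K r))) P = true
    · have hr' : r < N := by omega
      obtain ⟨D', P', Q', t', h1, h2⟩ := hs.apply hξη hmv hr' (search K dg mv r)
      refine ih hr'.le (fun i hi => hz i (by omega)) h2 ?_
      rw [← h1]
      exact search_succ h hb (ZMod.val_lt _) fun hd => by rw [hz r (by omega) hd, ZMod.val_zero]
    · obtain ⟨rfl, rfl, rfl, -⟩ := hs
      have hlt : ∀ e ∈ W, (e.init + costFrom N ξ η (r + 1) e.w z) + capacity ξ η (r + 1) < 64 := by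
        intro e he
        have := hcap e he
        have := capacity_add_costFrom_le (ξ := ξ) (η := η) hr e.w z
        omega
      rw [hK, Nat.add_eq, pack_map_add, land_flags_eq_self_iff _ _ hlt] at hb
      push Not at hb
      obtain ⟨e, he, hp, hd⟩ := hb
      refine ⟨e, he, Or.inl ⟨?_, ?_⟩⟩
      · have := costFrom_zero_le (ξ := ξ) (η := η) hr e.w z
        omega
      · refine hp.imp_right fun ⟨hq, M, _, hM⟩ => ⟨hq, M, Nat.zero_le _, hM⟩

theorem follow_spec (hξη : ξ ≠ η) (hmv : MoveSpec N ξ η W mv) {α : Type} {k : ℕ → ℕ → ℕ → α}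
    {zf : ℕ → ℕ} {r : ℕ} (hr : r ≤ N) {D P Q t : ℕ} (hz : ∀ i, i < r → zf i = (z i).val)
    (hs : State N ξ η W z r D P Q t) :
    ∃ D' P' Q' t', follow mv zf k r D P Q t = k D' P' Q' ∧ State N ξ η W z 0 D' P' Q' t' := by
  induction r generalizing D P Q t with
  | zero => exact ⟨D, P, Q, t, rfl, hs⟩
  | succ r ih =>
    have hr' : r < N := by omega
    obtain ⟨D', P', Q', t', h1, h2⟩ := hs.apply hξη hmv hr' (follow mv zf k r)
    rw [follow_succ, hz r (by omega), h1]
    exact ih hr'.le (fun i hi => hz i (by omega)) h2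

/-- The initial state. -/
theorem State.initial (hW : ∀ e ∈ W, ∀ i, N ≤ i → e.w i = 0) (hz : ∀ i, N ≤ i → z i = 0) :
    State N ξ η W z N (pack (W.map fun e => e.init)) (pack (W.map fun e => 32 * ind e.p))
      (pack (W.map fun e => 32 * ind e.q)) 0 where
  dist := pack_map_congr fun e _ => by simp [costFrom]
  lt := pack_map_congr fun e he => by
    congr 2
    refine propext ⟨Or.inl, ?_⟩
    rintro (h | ⟨_, M, hM, _, h⟩)
    · exact h
    · rw [hz M hM, ZMod.val_zero] at h
      exact absurd h (Nat.not_lt_zero _)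
  eq := pack_map_congr fun e he => by
    congr 2
    refine propext ⟨fun h => ⟨h, fun i hi => by rw [hW e he i hi, hz i hi]⟩, And.left⟩
  mem := by
    split_ifs with h
    · rw [hz _ h, ZMod.val_zero]
    · rfl

end Search


/-! ### Computing the packed data of a linear code from a basis. -/

section Certificates

/-- The coordinate with index `i` of the word whose decimal expansion is `b`. -/
def dig (b i : ℕ) : ℕ := b / 10 ^ i % 10 % 3

/-- The numbers flagging the linear combinations of basis words with coordinate `0`, `1`, `2`,
computed from the corresponding coordinates of the basis words. -/
def masks : List ℕ → ℕ × ℕ × ℕ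
  | [] => (1, 0, 0)
  | b :: bs =>
    let m := masks bs
    let s := 64 ^ 3 ^ bs.length
    -- The three blocks contain the words `c`, `b + c` and `2b + c`. For these to have value `a`,
    -- the word `c` must have value `a`, `a - b` and `a - 2b` respectively, where `b` stands for its
    -- own value.
    match b with
    | 0 => (m.1 + (s * m.1 + s * s * m.1), m.2.1 + (s * m.2.1 + s * s * m.2.1),
        m.2.2 + (s * m.2.2 + s * s * m.2.2))
    | 1 => (m.1 + (s * m.2.2 + s * s * m.2.1), m.2.1 + (s * m.1 + s * s * m.2.2),
        m.2.2 + (s * m.2.1 + s * s * m.1))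
    | _ => (m.1 + (s * m.2.1 + s * s * m.2.2), m.2.1 + (s * m.2.2 + s * s * m.1),
        m.2.2 + (s * m.1 + s * s * m.2.1))

/-- `masks` for a list of words extended by the words `xs`. -/
def colMasks (xs bs : List ℕ) (f : ℕ → ℕ) : ℕ × ℕ × ℕ :=
  xs.foldr (fun x m => ((bif Nat.beq (f x) 0 then 1 else 0) + 64 * m.1,
    (bif Nat.beq (f x) 1 then 1 else 0) + 64 * m.2.1,
    (bif Nat.beq (f x) 2 then 1 else 0) + 64 * m.2.2)) (masks (bs.map f))

/-- Selection of a component. -/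
def sel (x y z : ℕ) : ℕ → ℕ
  | 0 => x
  | 1 => y
  | _ => z

/-- The flags of the words whose coordinate is not `a`. -/
def others (m : ℕ × ℕ × ℕ) (a : ℕ) : ℕ :=
  sel (m.2.1 + m.2.2) (m.1 + m.2.2) (m.1 + m.2.1) a

/-- The moves for the words `xs` and the linear combinations of the words `bs`. -/
noncomputable def moveOf (ξ η : ℕ) (xs bs : List ℕ) (r t a : ℕ) : Move :=
  let e := colMasks xs bs fun b => dig b r
  force ((bif Nat.beq r η then 0 else others e a) + (bif Nat.beq r (min ξ η) then
    others (colMasks xs bs fun b => (dig b ξ + dig b η) % 3) ((a + t) % 3) else 0)) fun A =>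
  force (32 * sel 0 e.1 (e.1 + e.2.1) a) fun L =>
  force (32 * sel e.1 e.2.1 e.2.2 a) fun E =>
  ⟨A, L, E, bif Nat.beq r (max ξ η) then a else t⟩

/-- The number with all relevant base-`64` digits equal to `1`. -/
def ones (xs bs : List ℕ) : ℕ := (colMasks xs bs fun _ => 0).1

/-- The leading index of a word. -/
def lead (b : ℕ) : ℕ := ((List.range 16).filter fun l => Nat.ble (10 ^ (l + 1)) b).length

/-- The words are in echelon form, with leading coefficients `1`, the largest one first. -/
def isEchelon : List ℕ → Bool
  | [] => true
  | b :: bs => Nat.ble (10 ^ lead b) b && Nat.blt b (2 * 10 ^ lead b) &&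
      bs.all (fun c => Nat.blt c (10 ^ lead b)) && isEchelon bs

/-- The word whose coordinates are the decimal digits of `b`. -/
noncomputable def coord (b : ℕ) : Seq 3 :=
  Finsupp.onFinset (Finset.range b) (fun i => (dig b i : ZMod 3)) fun i hi => by
    rw [Finset.mem_range]
    by_contra h
    refine hi ?_
    have : b / 10 ^ i = 0 :=
      Nat.div_eq_of_lt (lt_of_le_of_lt (not_lt.1 h) (Nat.lt_pow_self (by norm_num)))
    simp [dig, this]

theorem coord_apply (b i : ℕ) : coord b i = (dig b i : ZMod 3) := rfl

theorem dig_lt (b i : ℕ) : dig b i < 3 := Nat.mod_lt _ (by norm_num)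

theorem dig_eq_val (b i : ℕ) : dig b i = (coord b i).val := by
  rw [coord_apply, ZMod.val_cast_of_lt (dig_lt b i)]

theorem coord_eq_zero {b n : ℕ} (h : b < 10 ^ n) {i : ℕ} (hi : n ≤ i) : coord b i = 0 := by
  have : b / 10 ^ i = 0 :=
    Nat.div_eq_of_lt (h.trans_le (Nat.pow_le_pow_right (by norm_num) hi))
  simp [coord_apply, dig, this]

theorem coord_lead {b n : ℕ} (h : 10 ^ n ≤ b) (h' : b < 2 * 10 ^ n) : coord b n = 1 := by
  have : b / 10 ^ n = 1 := Nat.div_eq_of_lt_le (by simpa using h) (by simpa using h')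
  simp [coord_apply, dig, this]

/-- All linear combinations of the words described by `bs`. -/
noncomputable def spanWords : List ℕ → List (Seq 3)
  | [] => [0]
  | b :: bs => spanWords bs ++ ((spanWords bs).map (coord b + ·) ++
      (spanWords bs).map (2 • coord b + ·))

theorem length_spanWords (bs : List ℕ) : (spanWords bs).length = 3 ^ bs.length := by
  induction bs with
  | nil => rfl
  | cons b bs ih =>
    simp only [spanWords, List.length_append, List.length_map, ih, List.length_cons]
    ring

/-- The space spanned by the words described by `bs`. -/
noncomputable def codeSpan (bs : List ℕ) : Submodule (ZMod 3) (Seq 3) :=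
  Submodule.span (ZMod 3) {c | ∃ b ∈ bs, c = coord b}

theorem codeSpan_cons (b : ℕ) (bs : List ℕ) :
    codeSpan (b :: bs) = Submodule.span (ZMod 3) (insert (coord b) {c | ∃ b ∈ bs, c = coord b}) := by
  rw [codeSpan]
  congr 1
  ext c
  simp

theorem mem_spanWords {bs : List ℕ} {c : Seq 3} : c ∈ spanWords bs ↔ c ∈ codeSpan bs := by
  induction bs generalizing c with
  | nil => simp [spanWords, codeSpan]
  | cons b bs ih =>
    rw [codeSpan_cons, Submodule.mem_span_insert]
    simp only [spanWords, List.mem_append, List.mem_map]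
    constructor
    · rintro (h | ⟨x, hx, rfl⟩ | ⟨x, hx, rfl⟩)
      · exact ⟨0, c, ih.1 h, by simp⟩
      · exact ⟨1, x, ih.1 hx, by simp⟩
      · exact ⟨2, x, ih.1 hx, by rw [two_smul, two_smul]⟩
    · rintro ⟨a, x, hx, rfl⟩
      have hx' := ih.2 hx
      fin_cases a
      · refine Or.inl ?_
        change (0 : ZMod 3) • coord b + x ∈ spanWords bs
        rwa [zero_smul, zero_add]
      · refine Or.inr (Or.inl ⟨x, hx', ?_⟩)
        change coord b + x = (1 : ZMod 3) • coord b + x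
        rw [one_smul]
      · refine Or.inr (Or.inr ⟨x, hx', ?_⟩)
        change 2 • coord b + x = (2 : ZMod 3) • coord b + x
        rw [two_smul, two_smul]

/-- An arbitrary additive functional is allowed, so that single coordinates, the sum of the
coordinates `ξ` and `η`, and the zero functional behind `ones` are all covered. Passing from `c` to
`b + c` shifts the value by that of `b`. -/
theorem masks_spec {f : ℕ → ℕ} {φ : Seq 3 →+ ZMod 3} (hf : ∀ b, f b < 3)
    (hφ : ∀ b, φ (coord b) = (f b : ZMod 3)) (bs : List ℕ) :
    masks (bs.map f) = (pack ((spanWords bs).map fun c => ind (φ c = 0)),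
      pack ((spanWords bs).map fun c => ind (φ c = 1)),
      pack ((spanWords bs).map fun c => ind (φ c = 2))) := by
  induction bs with
  | nil =>
    have h1 : ¬ (0 : ZMod 3) = 1 := by decide
    have h2 : ¬ (0 : ZMod 3) = 2 := by decide
    simp [masks, spanWords, pack, ind, h1, h2]
  | cons b bs ih =>
    have key : ∀ u : Seq 3, ∀ k : ZMod 3, φ u = k → ∀ a a' : ZMod 3, a' = a - k →
        pack (((spanWords bs).map (u + ·)).map fun c => ind (φ c = a)) =
          pack ((spanWords bs).map fun c => ind (φ c = a')) := by
      intro u k hu a a' ha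
      rw [List.map_map]
      refine pack_map_congr fun c _ => ?_
      rw [Function.comp_apply, map_add, hu, ha]
      congr 1
      refine propext ⟨fun h => by rw [← h]; ring, fun h => by rw [h]; ring⟩
    have hsplit : ∀ a a' a'' : ZMod 3, a' = a - φ (coord b) → a'' = a - 2 * φ (coord b) →
        pack ((spanWords (b :: bs)).map fun c => ind (φ c = a)) =
          pack ((spanWords bs).map fun c => ind (φ c = a)) +
          (64 ^ 3 ^ bs.length * pack ((spanWords bs).map fun c => ind (φ c = a')) +
          64 ^ 3 ^ bs.length * 64 ^ 3 ^ bs.length *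
            pack ((spanWords bs).map fun c => ind (φ c = a''))) := by
      intro a a' a'' h1 h2
      rw [spanWords, List.map_append, List.map_append, pack_append, pack_append,
        key (coord b) _ rfl a a' h1,
        key (2 • coord b) (2 * φ (coord b)) (by rw [map_nsmul, nsmul_eq_mul]; rfl) a a'' h2]
      simp only [List.length_map, length_spanWords]
      ring
    rw [List.map_cons]
    have hb := hf b
    have hv := hφ b
    obtain h | h | h : f b = 0 ∨ f b = 1 ∨ f b = 2 := by omega
    · rw [h] at hv ⊢
      simp only [masks, ih, List.length_map]
      rw [hsplit 0 0 0 (by rw [hv]; decide) (by rw [hv]; decide),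
        hsplit 1 1 1 (by rw [hv]; decide) (by rw [hv]; decide),
        hsplit 2 2 2 (by rw [hv]; decide) (by rw [hv]; decide)]
    · rw [h] at hv ⊢
      simp only [masks, ih, List.length_map]
      rw [hsplit 0 2 1 (by rw [hv]; decide) (by rw [hv]; decide),
        hsplit 1 0 2 (by rw [hv]; decide) (by rw [hv]; decide),
        hsplit 2 1 0 (by rw [hv]; decide) (by rw [hv]; decide)]
    · rw [h] at hv ⊢
      simp only [masks, ih, List.length_map]
      rw [hsplit 0 1 2 (by rw [hv]; decide) (by rw [hv]; decide),
        hsplit 1 2 0 (by rw [hv]; decide) (by rw [hv]; decide),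
        hsplit 2 0 1 (by rw [hv]; decide) (by rw [hv]; decide)]

/-- The words `xs`, which only serve for comparison, and the linear combinations of `bs`. -/
noncomputable def entries (xs bs : List ℕ) (p q : Prop) : List Entry :=
  -- Since `26 = 32 - 6`, the top bit of a codeword's digit is set exactly when its distance is at
  -- least 6. The words `xs` start at `0`, since for them only the order matters and not the
  -- distance.
  xs.map (fun x => ⟨coord x, 0, False, True⟩) ++ (spanWords bs).map fun c => ⟨c, 26, p, q⟩

theorem colMasks_spec {f : ℕ → ℕ} {φ : Seq 3 →+ ZMod 3} (hf : ∀ b, f b < 3)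
    (hφ : ∀ b, φ (coord b) = (f b : ZMod 3)) (xs bs : List ℕ) (p q : Prop) :
    colMasks xs bs f = (pack ((entries xs bs p q).map fun e => ind (φ e.w = 0)),
      pack ((entries xs bs p q).map fun e => ind (φ e.w = 1)),
      pack ((entries xs bs p q).map fun e => ind (φ e.w = 2))) := by
  induction xs with
  | nil =>
    simp only [colMasks, entries, List.foldr_nil, List.map_nil, List.nil_append, List.map_map]
    exact masks_spec hf hφ bs
  | cons x xs ih =>
    have hx := hf x
    have hv := hφ x
    have hcons : colMasks (x :: xs) bs f = ((bif Nat.beq (f x) 0 then 1 else 0) +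
      64 * (colMasks xs bs f).1, (bif Nat.beq (f x) 1 then 1 else 0) +
      64 * (colMasks xs bs f).2.1, (bif Nat.beq (f x) 2 then 1 else 0) +
      64 * (colMasks xs bs f).2.2) := rfl
    rw [hcons, ih]
    simp only [entries, List.map_cons, List.cons_append, pack, hv]
    obtain h | h | h : f x = 0 ∨ f x = 1 ∨ f x = 2 := by omega
    all_goals
      rw [h]
      refine Prod.ext ?_ (Prod.ext ?_ ?_)
      all_goals
        dsimp only
        congr 1
        first
          | rw [ind_pos (by decide)]; rfl
          | rw [ind_neg (by decide)]; rfl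

theorem others_spec {α : Type*} (W : List α) (g : α → ZMod 3) {a : ℕ} (ha : a < 3) :
    others (pack (W.map fun e => ind (g e = 0)), pack (W.map fun e => ind (g e = 1)),
      pack (W.map fun e => ind (g e = 2))) a = pack (W.map fun e => ind (g e ≠ (a : ZMod 3))) := by
  have key : ∀ x y : ZMod 3, ∀ a' : ZMod 3, (∀ k : ZMod 3, k ≠ a' ↔ (k = x ∨ k = y)) → x ≠ y →
      pack (W.map fun e => ind (g e = x)) + pack (W.map fun e => ind (g e = y)) =
        pack (W.map fun e => ind (g e ≠ a')) := by
    intro x y a' h hxy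
    rw [pack_map_add]
    refine pack_map_congr fun e _ => ?_
    rw [propext (h (g e))]
    by_cases h1 : g e = x
    · rw [ind_pos h1, ind_neg (fun h2 => hxy (h1.symm.trans h2)), ind_pos (Or.inl h1)]
    · by_cases h2 : g e = y
      · rw [ind_neg h1, ind_pos h2, ind_pos (Or.inr h2)]
      · rw [ind_neg h1, ind_neg h2, ind_neg (by tauto)]
  interval_cases a
  · exact key 1 2 _ (by decide) (by decide)
  · exact key 0 2 _ (by decide) (by decide)
  · exact key 0 1 _ (by decide) (by decide)

theorem moveOf_spec (N ξ η : ℕ) (xs bs : List ℕ) (p q : Prop) :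
    MoveSpec N ξ η (entries xs bs p q) (moveOf ξ η xs bs) := by
  intro r t a _ _ ha
  set W := entries xs bs p q
  have hcol := colMasks_spec (f := fun b => dig b r) (φ := Finsupp.applyAddHom r)
    (fun b => dig_lt b r) (fun b => rfl) xs bs p q
  have hsum := colMasks_spec (f := fun b => (dig b ξ + dig b η) % 3)
    (φ := Finsupp.applyAddHom ξ + Finsupp.applyAddHom η)
    (fun b => Nat.mod_lt _ (by norm_num)) (fun b => by
      change coord b ξ + coord b η = _
      rw [coord_apply, coord_apply, ZMod.natCast_mod, Nat.cast_add]) xs bs p q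
  simp only [moveOf, force_eq, hcol, hsum]
  rw [others_spec W _ ha, others_spec W _ (Nat.mod_lt _ (by norm_num))]
  congr 1
  · rw [← pack_map_add]
    congr 1
    · by_cases h : r = η
      · have hb : Nat.beq r η = true := by rwa [Nat.beq_eq]
        rw [hb, cond_true, ← pack_map_zero W]
        exact pack_map_congr fun e _ => (ind_neg (by tauto)).symm
      · have hb : Nat.beq r η = false := by simpa [← Nat.beq_eq] using h
        rw [hb, cond_false]
        refine pack_map_congr fun e _ => ?_
        congr 1
        exact propext ⟨fun h' => ⟨h, h'⟩, And.right⟩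
    · by_cases h : r = min ξ η
      · have hb : Nat.beq r (min ξ η) = true := by rwa [Nat.beq_eq]
        rw [hb, cond_true]
        refine pack_map_congr fun e _ => ?_
        rw [ZMod.natCast_mod, Nat.cast_add]
        congr 1
        exact propext ⟨fun h' => ⟨h, h'⟩, And.right⟩
      · have hb : Nat.beq r (min ξ η) = false := by simpa [← Nat.beq_eq] using h
        rw [hb, cond_false, ← pack_map_zero W]
        exact pack_map_congr fun e _ => (ind_neg (by tauto)).symm
  · rw [← mul_pack_map]
    congr 1
    interval_cases a
    · simp only [sel]
      refine (pack_map_zero W).symm.trans (pack_map_congr fun e _ => (ind_neg ?_).symm)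
      exact Nat.not_lt_zero _
    · refine pack_map_congr fun e _ => ?_
      congr 1
      simp
    · simp only [sel]
      rw [pack_map_add]
      refine pack_map_congr fun e _ => ?_
      simp only [Finsupp.applyAddHom_apply]
      have h3 : ∀ k : ZMod 3, (k = 0 ∧ k.val < 2 ∧ ¬ k = 1) ∨ (k = 1 ∧ k.val < 2 ∧ ¬ k = 0) ∨
        (k = 2 ∧ ¬ k.val < 2 ∧ ¬ k = 0 ∧ ¬ k = 1) := by decide
      obtain ⟨h, h', h''⟩ | ⟨h, h', h''⟩ | ⟨_, h, h', h''⟩ := h3 (e.w r)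
      · rw [ind_pos h, ind_neg h'', ind_pos h']
      · rw [ind_pos h, ind_neg h'', ind_pos h']
      · rw [ind_neg h', ind_neg h'', ind_neg h]
  · rw [← mul_pack_map]
    interval_cases a <;> rfl
  · by_cases h : r = max ξ η
    · have hb : Nat.beq r (max ξ η) = true := by rwa [Nat.beq_eq]
      rw [hb, cond_true, if_pos h]
    · have hb : Nat.beq r (max ξ η) = false := by simpa [← Nat.beq_eq] using h
      rw [hb, cond_false, if_neg h]

theorem ones_spec (xs bs : List ℕ) (p q : Prop) :
    ones xs bs = pack ((entries xs bs p q).map fun _ => 1) := by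
  rw [ones, colMasks_spec (f := fun _ => 0) (φ := 0) (fun _ => by norm_num) (fun _ => by simp)
    xs bs p q]
  exact pack_map_congr fun e _ => ind_pos rfl

end Certificates


/-! ### The checks performed on a certificate. -/

/-- The data describing a lexicographic code that is linear and of maximal dimension: a basis `bs`
of the code, the next word `v`, and a word `z` that obstructs linearity of the next codes. -/
structure Certificate where
  N : ℕ
  n : ℕ
  ξ : ℕ
  η : ℕ
  bs : List ℕ
  v : ℕ
  z : ℕ

namespace Certificate

variable (R : Certificate)

/-- Every word with coordinates below `n` that is not in the code is close to a smaller codeword. -/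
noncomputable def checkCode : Bool :=
  search (fun r => capacity R.ξ R.η (r + 1) * ones [] R.bs)
    (Nat.ble R.n) (moveOf R.ξ R.η [] R.bs) R.N
    (26 * ones [] R.bs) 0 (32 * ones [] R.bs) 0

/-- Every reduced word that is smaller than `v` is close to a codeword. -/
noncomputable def checkNext : Bool :=
  search (fun r => capacity R.ξ R.η (r + 1) * ones [R.v] R.bs)
    (fun i => R.bs.any fun b => Nat.beq (lead b) i)
    (moveOf R.ξ R.η [R.v] R.bs) R.N
    -- The lowest digit belongs to `v`, whence the shift by 64. The codewords are flagged in `P`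
    -- from the start, as their position in the order is irrelevant here; only `v` is flagged in `Q`
    -- and compared with the branch.
    (64 * (26 * ones [] R.bs)) (64 * (32 * ones [] R.bs)) 32 0

/-- The code spanned by `v` and `bs` has minimum distance at least `6`. -/
noncomputable def checkDist : Bool :=
  follow (moveOf R.ξ R.η [] (R.v :: R.bs)) (fun _ => 0)
    -- Along the zero branch the distances are weights. At the end `Q` flags only the zero word,
    -- which is exempt from the weight bound.
    (fun D _ Q => Nat.beq (Nat.lor (Nat.land (32 * ones [] (R.v :: R.bs)) D) Q)
      (32 * ones [] (R.v :: R.bs))) R.N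
    (26 * ones [] (R.v :: R.bs)) 0 (32 * ones [] (R.v :: R.bs)) 0

/-- The word `z` is not in the code spanned by `v` and `bs`, it is far from all smaller words of
that code, and there is a larger one. -/
noncomputable def checkWitness : Bool :=
  follow (moveOf R.ξ R.η [] (R.v :: R.bs)) (dig R.z)
    (fun D P Q => Nat.beq (Nat.land P D) P && Nat.beq Q 0 &&
      !Nat.beq P (32 * ones [] (R.v :: R.bs))) R.N
    (26 * ones [] (R.v :: R.bs)) 0 (32 * ones [] (R.v :: R.bs)) 0

/-- The shape of the data. -/
noncomputable def checkShape : Bool :=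
  -- The bound 38 keeps every digit below `26 + 38 = 64`. The list `bs` is increasing, so it is
  -- reversed to have the largest leading index first.
  !Nat.beq R.ξ R.η && Nat.ble R.n R.N && Nat.blt (capacity R.ξ R.η R.N) 38 &&
    isEchelon (R.v :: R.bs.reverse) && Nat.blt R.v (10 ^ R.N) &&
    R.bs.all (fun b => Nat.blt b (10 ^ R.n)) && Nat.blt R.z (10 ^ (lead R.v + 1))

/-- All checks. -/
noncomputable def check : Bool :=
  R.checkShape && R.checkDist && R.checkWitness && R.checkNext && R.checkCode

end Certificate

/-! ### Spans of echelon families and the codes they define. -/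

theorem eq_zero_of_mem_codeSpan {bs : List ℕ} {n : ℕ} (hb : ∀ b ∈ bs, b < 10 ^ n) {c : Seq 3}
    (hc : c ∈ codeSpan bs) {i : ℕ} (hi : n ≤ i) : c i = 0 := by
  induction hc using Submodule.span_induction with
  | mem x hx =>
    obtain ⟨b, hbs, rfl⟩ := hx
    exact coord_eq_zero (hb b hbs) hi
  | zero => rfl
  | add x y _ _ hx hy => rw [Finsupp.add_apply, hx, hy, add_zero]
  | smul a x _ hx => rw [Finsupp.smul_apply, hx, smul_zero]

theorem isEchelon_cons {b : ℕ} {bs : List ℕ} : isEchelon (b :: bs) = true ↔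
    10 ^ lead b ≤ b ∧ b < 2 * 10 ^ lead b ∧ (∀ c ∈ bs, c < 10 ^ lead b) ∧ isEchelon bs = true := by
  simp only [isEchelon, Bool.and_eq_true, Nat.ble_eq, Nat.blt_eq, List.all_eq_true, and_assoc]

theorem coord_notMem_codeSpan {b : ℕ} {bs : List ℕ} (h : isEchelon (b :: bs) = true) :
    coord b ∉ codeSpan bs := by
  obtain ⟨h1, h2, h3, -⟩ := isEchelon_cons.1 h
  intro hmem
  have := eq_zero_of_mem_codeSpan h3 hmem le_rfl
  rw [coord_lead h1 h2] at this
  exact one_ne_zero this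

theorem bounds_of_isEchelon {bs : List ℕ} (h : isEchelon bs = true) :
    ∀ b ∈ bs, 10 ^ lead b ≤ b ∧ b < 2 * 10 ^ lead b := by
  induction bs with
  | nil => simp
  | cons b bs ih =>
    obtain ⟨h1, h2, -, h4⟩ := isEchelon_cons.1 h
    intro c hc
    rcases List.mem_cons.1 hc with rfl | hc
    · exact ⟨h1, h2⟩
    · exact ih h4 c hc

theorem exists_basis_of_isEchelon {bs : List ℕ} (h : isEchelon bs = true) :
    ∃ s : Finset (Seq 3), s.card = bs.length ∧ (s : Set (Seq 3)) = {c | ∃ b ∈ bs, c = coord b} ∧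
      LinearIndepOn (ZMod 3) id (s : Set (Seq 3)) := by
  classical
  induction bs with
  | nil => exact ⟨∅, by simp⟩
  | cons b bs ih =>
    obtain ⟨s, hs, hs', hli⟩ := ih (isEchelon_cons.1 h).2.2.2
    have hnot : coord b ∉ Submodule.span (ZMod 3) (s : Set (Seq 3)) := by
      rw [hs']
      exact coord_notMem_codeSpan h
    refine ⟨insert (coord b) s, ?_, ?_, ?_⟩
    · rw [Finset.card_insert_of_notMem fun h => hnot (Submodule.subset_span h), hs,
        List.length_cons]
    · rw [Finset.coe_insert, hs']
      ext c
      simp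
    · rw [Finset.coe_insert]
      exact hli.id_insert hnot

theorem ncard_codeSpan {bs : List ℕ} (h : isEchelon bs = true) :
    (codeSpan bs : Set (Seq 3)).ncard = 3 ^ bs.length := by
  obtain ⟨s, hs, hs', hli⟩ := exists_basis_of_isEchelon h
  have hspan : codeSpan bs = Submodule.span (ZMod 3) (s : Set (Seq 3)) := by rw [hs']; rfl
  have hfin : Module.Finite (ZMod 3) (codeSpan bs) := by
    rw [hspan]
    exact Module.Finite.span_finset (ZMod 3) s
  have hrank : Module.finrank (ZMod 3) (codeSpan bs) = bs.length := by
    rw [hspan, finrank_span_finset_eq_card hli, hs]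
  have := Module.natCard_eq_pow_finrank (K := ZMod 3) (V := codeSpan bs)
  rwa [hrank, Nat.card_zmod] at this

theorem codeSpan_reverse (bs : List ℕ) : codeSpan bs.reverse = codeSpan bs := by
  simp [codeSpan]

/-- The code with basis `bs`, whose words are given by their `F`-coordinates. -/
noncomputable def code (F : Module.Basis ℕ (ZMod 3) (Seq 3)) (bs : List ℕ) :
    Submodule (ZMod 3) (Seq 3) :=
  (codeSpan bs).comap F.repr.toLinearMap

theorem mem_code {F : Module.Basis ℕ (ZMod 3) (Seq 3)} {bs : List ℕ} {x : Seq 3} :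
    x ∈ code F bs ↔ F.repr x ∈ codeSpan bs := Iff.rfl

theorem code_cons (F : Module.Basis ℕ (ZMod 3) (Seq 3)) (b : ℕ) (bs : List ℕ) :
    code F (b :: bs) = code F bs ⊔ Submodule.span (ZMod 3) {F.repr.symm (coord b)} := by
  have h (bs : List ℕ) : code F bs = (codeSpan bs).map F.repr.symm.toLinearMap :=
    Submodule.comap_equiv_eq_map_symm F.repr (codeSpan bs)
  rw [h, h, codeSpan_cons, Submodule.span_insert, Submodule.map_sup, Submodule.map_span,
    Set.image_singleton, sup_comm]
  rfl

/-- On words with coordinates below `N`, the distance is given by all `F`-coordinates except the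
one with index `η`, and the sum of those with indices `ξ` and `η`. -/
def HasProfile (F : Module.Basis ℕ (ZMod 3) (Seq 3)) (N ξ η : ℕ) : Prop :=
  ∀ x y, Below F N x → Below F N y → hdist x y = costFrom N ξ η 0 (F.repr x) (F.repr y)

theorem ltFrom_zero_iff {F : Module.Basis ℕ (ZMod 3) (Seq 3)} {x y : Seq 3} :
    LtFrom 0 (F.repr x) (F.repr y) ↔ lexLT F x y := by
  simp [LtFrom, lexLT]

theorem eqFrom_zero_iff {x y : Seq 3} : EqFrom 0 x y ↔ x = y := by
  simp [EqFrom, Finsupp.ext_iff]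

/-! ### Soundness of the checks. -/

namespace Certificate

theorem shape {R : Certificate} (h : R.checkShape = true) : R.ξ ≠ R.η ∧ R.n ≤ R.N ∧
    capacity R.ξ R.η R.N < 38 ∧ isEchelon (R.v :: R.bs.reverse) = true ∧ R.v < 10 ^ R.N ∧
    (∀ b ∈ R.bs, b < 10 ^ R.n) ∧ R.z < 10 ^ (lead R.v + 1) := by
  simpa only [checkShape, Bool.and_eq_true, and_assoc, Bool.not_eq_true', ← Bool.not_eq_true,
    Nat.beq_eq, Nat.ble_eq, Nat.blt_eq, List.all_eq_true] using h

variable {R : Certificate} {F : Module.Basis ℕ (ZMod 3) (Seq 3)}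

theorem lead_lt (h : R.checkShape = true) : lead R.v < R.N := by
  obtain ⟨-, -, -, hech, hv, -⟩ := shape h
  have h1 := (isEchelon_cons.1 hech).1.trans_lt hv
  exact (Nat.pow_lt_pow_iff_right (by norm_num)).1 h1

theorem lt_of_mem_cons (h : R.checkShape = true) : ∀ b ∈ R.v :: R.bs, b < 10 ^ R.N := by
  obtain ⟨-, hn, -, -, hv, hb, -⟩ := shape h
  intro b hbm
  rcases List.mem_cons.1 hbm with rfl | hbm
  · exact hv
  · exact (hb b hbm).trans_le (Nat.pow_le_pow_right (by norm_num) hn)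

theorem entries_supported {xs bs : List ℕ} {p q : Prop} {N : ℕ} (hx : ∀ x ∈ xs, x < 10 ^ N)
    (hb : ∀ b ∈ bs, b < 10 ^ N) : ∀ e ∈ entries xs bs p q, ∀ i, N ≤ i → e.w i = 0 := by
  intro e he i hi
  rcases List.mem_append.1 he with he | he
  · obtain ⟨x, hxs, rfl⟩ := List.mem_map.1 he
    exact coord_eq_zero (hx x hxs) hi
  · obtain ⟨c, hc, rfl⟩ := List.mem_map.1 he
    exact eq_zero_of_mem_codeSpan hb (mem_spanWords.1 hc) hi

theorem entries_init_le (xs bs : List ℕ) (p q : Prop) : ∀ e ∈ entries xs bs p q, e.init ≤ 26 := by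
  intro e he
  rcases List.mem_append.1 he with he | he
  · obtain ⟨x, -, rfl⟩ := List.mem_map.1 he
    exact Nat.zero_le _
  · obtain ⟨c, -, rfl⟩ := List.mem_map.1 he
    exact le_rfl

/-- The initial state when all words are linear combinations of the basis. -/
theorem initial_state {N ξ η : ℕ} {bs : List ℕ} (hb : ∀ b ∈ bs, b < 10 ^ N) {z : Seq 3}
    (hz : ∀ i, N ≤ i → z i = 0) : State N ξ η (entries [] bs False True) z N
      (26 * ones [] bs) 0 (32 * ones [] bs) 0 := by
  have h := State.initial (N := N) (ξ := ξ) (η := η)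
    (entries_supported (xs := []) (p := False) (q := True) (by simp) hb) hz
  convert h using 1
  · rw [ones_spec [] bs False True, mul_pack_map]
    refine pack_map_congr fun e he => ?_
    obtain ⟨c, -, rfl⟩ := List.mem_map.1 he
    rfl
  · rw [← pack_map_zero (entries [] bs False True)]
    refine pack_map_congr fun e he => ?_
    obtain ⟨c, -, rfl⟩ := List.mem_map.1 he
    exact (by simp [ind] : 0 = 32 * ind False)
  · rw [ones_spec [] bs False True, mul_pack_map]
    refine pack_map_congr fun e he => ?_
    obtain ⟨c, -, rfl⟩ := List.mem_map.1 he
    exact (by simp [ind] : 32 * 1 = 32 * ind True)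

theorem forall_entries {bs : List ℕ} {P : Seq 3 → Prop}
    (h : ∀ e ∈ entries [] bs False True, P e.w) : ∀ c ∈ codeSpan bs, P c :=
  fun c hc => h ⟨c, 26, False, True⟩ (List.mem_map.2 ⟨c, mem_spanWords.2 hc, rfl⟩)

theorem entries_nil {bs : List ℕ} {e : Entry} (he : e ∈ entries [] bs False True) :
    e.w ∈ codeSpan bs ∧ e.init = 26 ∧ ¬ e.p ∧ e.q := by
  obtain ⟨c, hc, rfl⟩ := List.mem_map.1 he
  exact ⟨mem_spanWords.1 hc, rfl, id, trivial⟩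

theorem final_dist_lt {N ξ η : ℕ} {bs : List ℕ} (hcap : capacity ξ η N < 38) (z : Seq 3) :
    ∀ e ∈ entries [] bs False True, e.init + costFrom N ξ η 0 e.w z < 64 := by
  intro e he
  have h1 := entries_init_le _ _ _ _ e he
  have h2 := capacity_add_costFrom_le (ξ := ξ) (η := η) (Nat.zero_le N) e.w z
  omega

theorem six_le_cost (h : R.checkShape = true) (hd : R.checkDist = true) :
    ∀ c ∈ codeSpan (R.v :: R.bs), c ≠ 0 → 6 ≤ costFrom R.N R.ξ R.η 0 c 0 := by
  obtain ⟨hne, hn, hcap, hech, hv, hb, hz⟩ := shape h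
  obtain ⟨D, P, Q, t, h1, h2⟩ := follow_spec (k := fun D _ Q => Nat.beq
      (Nat.lor (Nat.land (32 * ones [] (R.v :: R.bs)) D) Q) (32 * ones [] (R.v :: R.bs)))
    hne (moveOf_spec R.N R.ξ R.η [] (R.v :: R.bs) False True) le_rfl
    (zf := fun _ => 0) (z := 0) (fun i _ => by simp)
    (initial_state (ξ := R.ξ) (η := R.η) (lt_of_mem_cons h) (z := 0) (fun i _ => rfl))
  obtain ⟨rfl, rfl, rfl, -⟩ := h2
  rw [checkDist, h1, Nat.beq_eq] at hd
  have hmask : 32 * ones [] (R.v :: R.bs) =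
      pack ((entries [] (R.v :: R.bs) False True).map fun _ => 32 * ind True) := by
    rw [ones_spec [] _ False True, mul_pack_map, ind_pos trivial]
  rw [hmask, land_pack_flag _ _ (final_dist_lt hcap 0), lor_pack_flags, flags_eq_iff] at hd
  intro c hc hc0
  have := (hd ⟨c, 26, False, True⟩ (List.mem_map.2 ⟨c, mem_spanWords.2 hc, rfl⟩)).2 trivial
  rcases this with ⟨-, h⟩ | ⟨-, h⟩
  · dsimp only at h
    omega
  · exact absurd (eqFrom_zero_iff.1 h) hc0

theorem witness_spec (h : R.checkShape = true) (hw : R.checkWitness = true) :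
    (∀ c ∈ codeSpan (R.v :: R.bs), LtFrom 0 c (coord R.z) →
      6 ≤ costFrom R.N R.ξ R.η 0 c (coord R.z)) ∧
    coord R.z ∉ codeSpan (R.v :: R.bs) ∧
    ∃ c ∈ codeSpan (R.v :: R.bs), ¬ LtFrom 0 c (coord R.z) := by
  obtain ⟨hne, hn, hcap, hech, hv, hb, hz⟩ := shape h
  have hzN : ∀ i, R.N ≤ i → coord R.z i = 0 := fun i hi =>
    coord_eq_zero hz (by have := lead_lt h; omega)
  obtain ⟨D, P, Q, t, h1, h2⟩ := follow_spec (k := fun D P Q => Nat.beq (Nat.land P D) P &&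
      Nat.beq Q 0 && !Nat.beq P (32 * ones [] (R.v :: R.bs)))
    hne (moveOf_spec R.N R.ξ R.η [] (R.v :: R.bs) False True) le_rfl
    (zf := dig R.z) (z := coord R.z) (fun i _ => dig_eq_val R.z i)
    (initial_state (ξ := R.ξ) (η := R.η) (lt_of_mem_cons h) hzN)
  obtain ⟨rfl, rfl, rfl, -⟩ := h2
  rw [checkWitness, h1, Bool.and_eq_true, Bool.and_eq_true, Bool.not_eq_true',
    land_flags_eq_self_iff _ _ (final_dist_lt hcap _), flags_eq_zero_iff] at hw
  obtain ⟨⟨h3, h4⟩, h5⟩ := hw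
  refine ⟨forall_entries fun e he hlt => ?_, fun hmem => ?_, ?_⟩
  · obtain ⟨-, h6, -, h7⟩ := entries_nil he
    have := h3 e he (Or.inr ⟨h7, hlt⟩)
    omega
  · exact h4 ⟨_, 26, False, True⟩ (List.mem_map.2 ⟨_, mem_spanWords.2 hmem, rfl⟩)
      ⟨trivial, eqFrom_zero_iff.2 rfl⟩
  · by_contra! hcon
    rw [← Bool.not_eq_true, Nat.beq_eq] at h5
    refine h5 ?_
    rw [ones_spec [] _ False True, mul_pack_map]
    refine pack_map_congr fun e he => ?_
    obtain ⟨h6, -, -, h7⟩ := entries_nil he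
    rw [ind_pos (Or.inr ⟨h7, hcon _ h6⟩)]

theorem code_spec (h : R.checkShape = true) (hc : R.checkCode = true) {z : Seq 3}
    (hz : ∀ i, R.n ≤ i → z i = 0) (hzc : z ∉ codeSpan R.bs) :
    ∃ c ∈ codeSpan R.bs, LtFrom 0 c z ∧ costFrom R.N R.ξ R.η 0 c z < 6 := by
  obtain ⟨hne, hn, hcap, hech, hv, hb, -⟩ := shape h
  obtain ⟨e, he, h1⟩ := search_sound hne
    (moveOf_spec R.N R.ξ R.η [] R.bs False True)
    (K := fun r => capacity R.ξ R.η (r + 1) * ones [] R.bs)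
    (fun r => by
      rw [ones_spec [] R.bs False True, mul_pack_map]
      simp only [mul_one])
    (fun e he => by have := entries_init_le _ _ _ _ e he; omega) le_rfl
    (fun i _ hi => hz i (Nat.ble_eq ▸ hi))
    (initial_state (ξ := R.ξ) (η := R.η)
      (fun b hb' => lt_of_mem_cons h b (List.mem_cons_of_mem _ hb'))
      fun i hi => hz i (hn.trans hi)) hc
  obtain ⟨h2, h3, h4, -⟩ := entries_nil he
  rcases h1 with ⟨h5, h6⟩ | ⟨-, h5⟩
  · exact ⟨e.w, h2, (h6.resolve_left h4).2, by omega⟩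
  · exact absurd (eqFrom_zero_iff.1 h5 ▸ h2) hzc

/-- The search provides either a codeword close to `z`, which `hfar` excludes, or the information
that `v` is smaller than or equal to `z`. -/
theorem next_spec (h : R.checkShape = true) (hc : R.checkNext = true) {z : Seq 3}
    (hz : ∀ i, R.N ≤ i → z i = 0) (hlead : ∀ b ∈ R.bs, z (lead b) = 0)
    (hfar : ∀ c ∈ codeSpan R.bs, 6 ≤ costFrom R.N R.ξ R.η 0 c z) :
    z = coord R.v ∨ LtFrom 0 (coord R.v) z := by
  obtain ⟨hne, hn, hcap, hech, hv, hb, -⟩ := shape h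
  have hones : ones [] R.bs = pack ((spanWords R.bs).map fun _ => 1) := by
    rw [ones_spec [] R.bs False True, entries, List.map_nil, List.nil_append, List.map_map]
    rfl
  have hs := State.initial (N := R.N) (ξ := R.ξ) (η := R.η) (W := entries [R.v] R.bs True False)
    (entries_supported (by simpa using hv)
      (fun b hb' => lt_of_mem_cons h b (List.mem_cons_of_mem _ hb'))) hz
  have hD : 64 * (26 * ones [] R.bs) =
      pack ((entries [R.v] R.bs True False).map fun e => e.init) := by
    rw [hones, mul_pack_map, entries]
    simp only [List.map_cons, List.map_nil, List.cons_append, List.nil_append, pack, List.map_map]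
    rw [zero_add]
    rfl
  have hP : 64 * (32 * ones [] R.bs) =
      pack ((entries [R.v] R.bs True False).map fun e => 32 * ind e.p) := by
    rw [hones, mul_pack_map, entries]
    simp only [List.map_cons, List.map_nil, List.cons_append, List.nil_append, pack, List.map_map]
    rw [ind_neg id, mul_zero, zero_add]
    congr 1
    exact pack_map_congr fun e _ => by rw [Function.comp_apply, ind_pos trivial]
  have hQ : 32 = pack ((entries [R.v] R.bs True False).map fun e => 32 * ind e.q) := by
    rw [entries]
    simp only [List.map_cons, List.map_nil, List.cons_append, List.nil_append, pack, List.map_map]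
    rw [ind_pos trivial, mul_one]
    have h0 : pack ((spanWords R.bs).map ((fun e : Entry => 32 * ind e.q) ∘
        fun c => ⟨c, 26, True, False⟩)) = 0 := by
      rw [← pack_map_zero (spanWords R.bs)]
      exact pack_map_congr fun e _ => by rw [Function.comp_apply, ind_neg id, mul_zero]
    rw [h0]
  rw [← hD, ← hP, ← hQ] at hs
  obtain ⟨e, he, h1⟩ := search_sound hne
    (moveOf_spec R.N R.ξ R.η [R.v] R.bs True False)
    (K := fun r => capacity R.ξ R.η (r + 1) * ones [R.v] R.bs)
    (fun r => by
      rw [ones_spec [R.v] R.bs True False, mul_pack_map]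
      simp only [mul_one])
    (fun e he => by have := entries_init_le _ _ _ _ e he; omega) le_rfl
    (fun i _ hi => by
      obtain ⟨b, hb1, hb2⟩ := List.any_eq_true.1 hi
      rw [Nat.beq_eq] at hb2
      rw [← hb2]
      exact hlead b hb1)
    hs hc
  rcases List.mem_append.1 he with he | he
  · rw [List.map_singleton, List.mem_singleton] at he
    subst he
    rcases h1 with ⟨-, h2⟩ | ⟨-, h2⟩
    · exact Or.inr (h2.resolve_left id).2
    · exact Or.inl (eqFrom_zero_iff.1 h2).symm
  · obtain ⟨c, hc, rfl⟩ := List.mem_map.1 he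
    rcases h1 with ⟨h2, -⟩ | ⟨h2, -⟩
    · have := hfar c (mem_spanWords.1 hc)
      dsimp only at h2
      omega
    · exact h2.elim

theorem below_code {bs : List ℕ} {n : ℕ} (hb : ∀ b ∈ bs, b < 10 ^ n) {x : Seq 3}
    (hx : x ∈ code F bs) : Below F n x :=
  fun _ hi => eq_zero_of_mem_codeSpan hb hx hi

theorem six_le_hdist (hF : HasProfile F R.N R.ξ R.η) (h : R.checkShape = true)
    (hd : R.checkDist = true) {x y : Seq 3} (hx : x ∈ code F (R.v :: R.bs))
    (hy : y ∈ code F (R.v :: R.bs)) (hxy : x ≠ y) : 6 ≤ hdist x y := by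
  have hsub := Submodule.sub_mem _ hx hy
  rw [hdist_eq_sub, hF _ _ (below_code (lt_of_mem_cons h) hsub) (by intro i _; simp), map_zero]
  refine six_le_cost h hd _ (mem_code.1 hsub) ?_
  simpa [sub_eq_zero] using hxy

theorem code_le (F : Module.Basis ℕ (ZMod 3) (Seq 3)) : code F R.bs ≤ code F (R.v :: R.bs) := by
  rw [code_cons]
  exact le_sup_left

theorem lexCode_eq (hF : HasProfile F R.N R.ξ R.η) (h : R.check = true) :
    lexCode F 6 R.bs.length = code F R.bs := by
  obtain ⟨⟨⟨⟨h1, h2⟩, -⟩, -⟩, h5⟩ : (((R.checkShape = true ∧ R.checkDist = true) ∧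
    R.checkWitness = true) ∧ R.checkNext = true) ∧ R.checkCode = true := by simpa [check] using h
  obtain ⟨hne, hn, hcap, hech, hv, hb, hz⟩ := shape h1
  refine lexCode_eq_of_covering (n := R.n) (by norm_num) ?_
    (fun x hx y hy hxy => six_le_hdist hF h1 h2 (code_le F hx) (code_le F hy) hxy)
    (fun x hx => below_code hb hx) fun z hz hzc => ?_
  · have hpre : (code F R.bs : Set (Seq 3)) = F.repr ⁻¹' (codeSpan R.bs : Set (Seq 3)) := rfl
    rw [hpre, Set.ncard_preimage_of_injective_subset_range F.repr.injective
      (by rw [F.repr.surjective.range_eq]; exact Set.subset_univ _), ← codeSpan_reverse,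
      ncard_codeSpan (isEchelon_cons.1 hech).2.2.2, List.length_reverse]
  · obtain ⟨c, hc, hlt, hcost⟩ := code_spec h1 h5 hz hzc
    have hc' : F.repr.symm c ∈ code F R.bs := by rwa [mem_code, LinearEquiv.apply_symm_apply]
    refine ⟨F.repr.symm c, hc', ?_, ?_⟩
    · rwa [← ltFrom_zero_iff, LinearEquiv.apply_symm_apply]
    · have hNz : Below F R.N z := fun i hi => hz i (hn.trans hi)
      have hNc : Below F R.N (F.repr.symm c) := fun i hi => below_code hb hc' i (hn.trans hi)
      rwa [hdist_comm, hF _ _ hNc hNz, LinearEquiv.apply_symm_apply]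

theorem isLead_of_bounds {b n : ℕ} (h1 : 10 ^ n ≤ b) (h2 : b < 2 * 10 ^ n) :
    IsLead F (F.repr.symm (coord b)) n := by
  refine ⟨?_, fun i hi => ?_⟩
  · rw [LinearEquiv.apply_symm_apply, coord_lead h1 h2]
  · rw [LinearEquiv.apply_symm_apply]
    refine coord_eq_zero (n := n + 1) ?_ hi
    rw [pow_succ]
    omega

theorem word_eq (hF : HasProfile F R.N R.ξ R.η) (h : R.check = true) :
    word F 6 (3 ^ R.bs.length) = F.repr.symm (coord R.v) := by
  have hV := lexCode_eq hF h
  obtain ⟨⟨⟨⟨h1, h2⟩, -⟩, h4⟩, -⟩ : (((R.checkShape = true ∧ R.checkDist = true) ∧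
    R.checkWitness = true) ∧ R.checkNext = true) ∧ R.checkCode = true := by simpa [check] using h
  obtain ⟨hne, hn, hcap, hech, hv, hb, hz⟩ := shape h1
  have hvmem : F.repr.symm (coord R.v) ∈ code F (R.v :: R.bs) := by
    rw [code_cons]
    exact (le_sup_right : _ ≤ code F R.bs ⊔ _) (Submodule.mem_span_singleton_self _)
  have hvnot : F.repr.symm (coord R.v) ∉ code F R.bs := by
    rw [mem_code, LinearEquiv.apply_symm_apply, ← codeSpan_reverse]
    exact coord_notMem_codeSpan hech
  refine word_eq_of_covering (n := R.N) hV (fun c hc => ?_)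
    (below_code (lt_of_mem_cons h1) hvmem) fun z hz hlead hfar => ?_
  · exact six_le_hdist hF h1 h2 hvmem (code_le F hc) fun h => hvnot (h ▸ hc)
  · have hres := next_spec h1 h4 (z := F.repr z) hz (fun b hbm => ?_) (fun c hc => ?_)
    · rcases hres with h | h
      · left
        rw [← h, LinearEquiv.symm_apply_apply]
      · right
        rwa [← ltFrom_zero_iff, LinearEquiv.apply_symm_apply]
    · have hbd := bounds_of_isEchelon (isEchelon_cons.1 hech).2.2.2 b (by simpa using hbm)
      refine hlead _ _ ?_ (isLead_of_bounds hbd.1 hbd.2)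
      rw [mem_code, LinearEquiv.apply_symm_apply]
      exact Submodule.subset_span ⟨b, hbm, rfl⟩
    · have hc' : F.repr.symm c ∈ code F R.bs := by rwa [mem_code, LinearEquiv.apply_symm_apply]
      have := hfar _ hc'
      rw [hdist_comm, hF _ _ (below_code (lt_of_mem_cons h1) (code_le F hc')) hz,
        LinearEquiv.apply_symm_apply] at this
      exact this

theorem maxDim_eq (hF : HasProfile F R.N R.ξ R.η) (h : R.check = true) :
    maxDim F 6 = R.bs.length := by
  have hV := lexCode_eq hF h
  have hw := word_eq hF h
  obtain ⟨⟨⟨⟨h1, -⟩, h3⟩, -⟩, -⟩ : (((R.checkShape = true ∧ R.checkDist = true) ∧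
    R.checkWitness = true) ∧ R.checkNext = true) ∧ R.checkCode = true := by simpa [check] using h
  obtain ⟨hne, hn, hcap, hech, hv, hb, hz⟩ := shape h1
  have hN := lead_lt h1
  obtain ⟨h4, h5, c, hc, hcz⟩ := witness_spec h1 h3
  have hzb : Below F (lead R.v + 1) (F.repr.symm (coord R.z)) := by
    intro i hi
    rw [LinearEquiv.apply_symm_apply]
    exact coord_eq_zero hz hi
  have hznot : F.repr.symm (coord R.z) ∉ code F (R.v :: R.bs) := by
    rwa [mem_code, LinearEquiv.apply_symm_apply]
  refine Lexicode.maxDim_eq ⟨_, hV.symm⟩ fun m hm =>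
    not_isLinearCode_of_witness hV hw
      (isLead_of_bounds (isEchelon_cons.1 hech).1 (isEchelon_cons.1 hech).2.1)
      (code_cons F R.v R.bs) hznot hzb (fun c hc hlt => ?_) ?_ hm
  · have := h4 _ hc (by
      rw [← ltFrom_zero_iff, LinearEquiv.apply_symm_apply] at hlt
      exact hlt)
    rwa [hdist_comm, hF _ _ (below_code (lt_of_mem_cons h1) hc) fun i hi => hzb i (by omega),
      LinearEquiv.apply_symm_apply]
  · have hc' : F.repr.symm c ∈ code F (R.v :: R.bs) := by
      rwa [mem_code, LinearEquiv.apply_symm_apply]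
    refine ⟨_, hc', ?_⟩
    -- The check yields a word of the code that is not smaller than `z`. It is not equal to `z`
    -- either, as `z` is outside the code, so it is larger.
    rcases lexLT_trichotomous (F := F) (F.repr.symm (coord R.z)) (F.repr.symm c) with h | h | h
    · exact h
    · exact absurd (h ▸ hc') hznot
    · rw [← ltFrom_zero_iff, LinearEquiv.apply_symm_apply, LinearEquiv.apply_symm_apply] at h
      exact absurd h hcz

end Certificate


/-! ### The certificates and their verification. -/

/-- The certificate for the standard basis. -/
def stdCert : Certificate :=
  ⟨9, 8, 9, 10, [111111, 11001122], 101010212, 101102021⟩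

/-- The certificates for the bases `F(ξ, η)` with `η ≤ 8`. -/
def lowCerts : ℕ → List Certificate
  | 0 => [
    ⟨9, 8, 0, 1, [111101, 11001102], 101010211, 101102022⟩,
    ⟨9, 8, 0, 2, [111011, 11001012], 101010121, 101102202⟩,
    ⟨9, 8, 0, 3, [110111, 11000112], 101011021, 101102202⟩,
    ⟨9, 8, 0, 4, [101111, 11000112], 101011021, 110012120⟩,
    ⟨9, 8, 0, 5, [11111, 11000112], 101101021, 110102120⟩,
    ⟨9, 8, 0, 6, [11111, 10100112], 101101021, 111002120⟩,
    ⟨9, 8, 0, 7, [11111, 1100112], 110101021, 111002120⟩,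
    ⟨9, 8, 0, 8, [11111, 1100112], 110101021, 111002120⟩]
  | 1 => [
    ⟨9, 8, 1, 0, [111110, 11001120], 101010211, 101102022⟩,
    ⟨9, 8, 1, 2, [111011, 11001021], 101010112, 101102220⟩,
    ⟨9, 8, 1, 3, [110111, 11000121], 101011012, 101102220⟩,
    ⟨9, 8, 1, 4, [101111, 11000121], 101011012, 110012102⟩,
    ⟨9, 8, 1, 5, [11111, 11000121], 101101012, 110102102⟩,
    ⟨9, 8, 1, 6, [11111, 10100121], 101101012, 111002102⟩,
    ⟨9, 8, 1, 7, [11111, 1100121], 110101012, 111002102⟩,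
    ⟨9, 8, 1, 8, [11111, 1100121], 110101012, 111002102⟩]
  | 2 => [
    ⟨9, 8, 2, 0, [111110, 11001121], 101010210, 101102021⟩,
    ⟨9, 8, 2, 1, [111101, 11001112], 101010201, 101102012⟩,
    ⟨9, 8, 2, 3, [110111, 11000122], 101011212, 101102021⟩,
    ⟨9, 8, 2, 4, [101111, 11000122], 101011212, 110012110⟩,
    ⟨9, 8, 2, 5, [11111, 11000122], 101101212, 110102110⟩,
    ⟨9, 8, 2, 6, [11111, 10100122], 101101212, 111002110⟩,
    ⟨9, 8, 2, 7, [11111, 1100122], 110101212, 111002110⟩,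
    ⟨9, 8, 2, 8, [11111, 1100122], 110101212, 111002110⟩]
  | 3 => [
    ⟨9, 8, 3, 0, [111110, 11001121], 101010212, 101102022⟩,
    ⟨9, 8, 3, 1, [111101, 11001112], 101010212, 101102001⟩,
    ⟨9, 8, 3, 2, [111011, 11001022], 101010212, 101102121⟩,
    ⟨9, 8, 3, 4, [101111, 11001022], 101011201, 110012121⟩,
    ⟨9, 8, 3, 5, [11111, 11001022], 101101201, 110102121⟩,
    ⟨9, 8, 3, 6, [11111, 10101022], 101101201, 111002121⟩,
    ⟨9, 8, 3, 7, [11111, 1101022], 110101201, 111002121⟩,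
    ⟨9, 8, 3, 8, [11111, 1101022], 110101201, 111002121⟩]
  | 4 => [
    ⟨9, 8, 4, 0, [111110, 11001122], 101010211, 101102021⟩,
    ⟨9, 8, 4, 1, [111101, 11001122], 101010202, 101102021⟩,
    ⟨9, 8, 4, 2, [111011, 11001122], 101010112, 101102021⟩,
    ⟨9, 8, 4, 3, [110111, 11001122], 101011012, 101100221⟩,
    ⟨9, 8, 4, 5, [11111, 11001122], 101100212, 110102021⟩,
    ⟨9, 8, 4, 6, [11111, 10101122], 101100212, 111002021⟩,
    ⟨9, 8, 4, 7, [11111, 1101122], 110100212, 111002021⟩,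
    ⟨9, 8, 4, 8, [11111, 1101122], 110100212, 111002021⟩]
  | 5 => [
    ⟨9, 8, 5, 0, [111110, 11001122], 101010212, 101102020⟩,
    ⟨9, 8, 5, 1, [111101, 11001122], 101010212, 101102011⟩,
    ⟨9, 8, 5, 2, [111011, 11001122], 101010212, 101102221⟩,
    ⟨9, 8, 5, 3, [110111, 11001122], 101010212, 101101021⟩,
    ⟨9, 8, 5, 4, [101111, 11001122], 101010212, 110012021⟩,
    ⟨9, 8, 5, 6, [101111, 10011122], 101010212, 111002021⟩,
    ⟨9, 8, 5, 7, [101111, 1011122], 110010212, 111002021⟩,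
    ⟨9, 8, 5, 8, [101111, 1011122], 110010212, 111002021⟩]
  | 6 => [
    ⟨9, 8, 6, 0, [111111, 11001121], 101010211, 101102020⟩,
    ⟨9, 8, 6, 1, [111111, 11001112], 101010202, 101102011⟩,
    ⟨9, 8, 6, 2, [111111, 11001022], 101010112, 101102221⟩,
    ⟨9, 8, 6, 3, [111111, 11000122], 101011012, 101102221⟩,
    ⟨9, 8, 6, 4, [111111, 11000122], 101002201, 110001212⟩,
    ⟨9, 8, 6, 5, [111111, 11000122], 101002201, 110001212⟩,
    ⟨9, 8, 6, 7, [111111, 1001122], 110010212, 110102021⟩,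
    ⟨9, 8, 6, 8, [111111, 1001122], 110010212, 110102021⟩]
  | 7 => [
    ⟨9, 8, 7, 0, [111111, 11001121], 101010212, 101102021⟩,
    ⟨9, 8, 7, 1, [111111, 11001112], 101010212, 101102021⟩,
    ⟨9, 8, 7, 2, [111111, 11001022], 101010212, 101102021⟩,
    ⟨9, 8, 7, 3, [111111, 11000122], 101010212, 101102021⟩,
    ⟨9, 8, 7, 4, [111111, 11000122], 101001212, 110002201⟩,
    ⟨9, 8, 7, 5, [111111, 11000122], 101001212, 110002201⟩,
    ⟨9, 8, 7, 6, [111111, 10001122], 101010212, 101102021⟩,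
    ⟨9, 8, 7, 8, [111111, 10001122], 101010212, 101102021⟩]
  | 8 => [
    ⟨9, 8, 8, 0, [111111, 11001122], 101010211, 101102020⟩,
    ⟨9, 8, 8, 1, [111111, 11001122], 101010202, 101102011⟩,
    ⟨9, 8, 8, 2, [111111, 11001122], 101010112, 101102221⟩,
    ⟨9, 8, 8, 3, [111111, 11001122], 101011012, 101102221⟩,
    ⟨9, 8, 8, 4, [111111, 11001122], 101000212, 110002021⟩,
    ⟨9, 8, 8, 5, [111111, 11001122], 101000212, 110002021⟩,
    ⟨9, 8, 8, 6, [111111, 11001122], 100010212, 100102021⟩,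
    ⟨9, 8, 8, 7, [111111, 11001122], 100010212, 100102021⟩]
  | _ => []

/-- The certificates for the bases `F(ξ, η)` with `η ≥ 10`. -/
def highCert : ℕ → Certificate
  | 0 => ⟨10, 9, 0, 10, [11111, 1100112, 110001012], 1010100011, 1011001110⟩
  | 1 => ⟨10, 9, 1, 10, [11111, 1100121, 110001021], 1010100011, 1011001101⟩
  | 2 => ⟨10, 9, 2, 10, [11111, 1100122, 110001201], 1010100220, 1011001100⟩
  | 3 => ⟨10, 9, 3, 10, [11111, 1101022, 110001202], 1010100112, 1010111000⟩
  | 4 => ⟨10, 9, 4, 10, [11111, 1101122, 110001212], 1010100111, 1010111002⟩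
  | 5 => ⟨10, 9, 5, 10, [101111, 1011122, 110001212], 1010010111, 1010111002⟩
  | 6 => ⟨10, 9, 6, 10, [111111, 1001122, 110001212], 1010010122, 1010102201⟩
  | 7 => ⟨10, 9, 7, 10, [111111, 10001122, 101001212], 1001010122, 1001102201⟩
  | _ => ⟨10, 9, 8, 10, [111111, 11001122, 100001212], 1001010212, 1001102021⟩

/-- The certificates for the bases `F(ξ, 9)`. -/
def golayCert : ℕ → Certificate
  | 0 => ⟨15, 12, 0, 9,
      [11111, 1100112, 110001012, 1010102210, 10010200202, 100010201001],
      111000000000011, 111000000011100⟩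
  | 1 => ⟨15, 12, 1, 9,
      [11111, 1100121, 110001021, 1010102201, 10010200220, 100010201010],
      111000000000011, 111000000011100⟩
  | 2 => ⟨15, 12, 2, 9,
      [11111, 1100122, 110001201, 1010102110, 10010200101, 100010201011],
      111000000000101, 111000000011010⟩
  | 3 => ⟨15, 12, 3, 9,
      [11111, 1101022, 110001202, 1010102112, 10010201010, 100010202200],
      111000000000111, 111000000011000⟩
  | 4 => ⟨15, 12, 4, 9,
      [11111, 1101122, 110001212, 1010100221, 10010201101, 100010202022],
      111000000000111, 111000000011000⟩
  | 5 => ⟨15, 12, 5, 9,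
      [101111, 1011122, 110001212, 1010010221, 10010021101, 100010022022],
      111000000000111, 111000000101000⟩
  | 6 => ⟨15, 12, 6, 9,
      [111111, 1001122, 110001212, 1010010221, 10010021120, 100010022011],
      111000000000111, 111000000111000⟩
  | 7 => ⟨15, 12, 7, 9,
      [111111, 10001122, 101001212, 1001010221, 10001021120, 100001022011],
      111000000000111, 111000000111000⟩
  | _ => ⟨15, 12, 8, 9,
      [111111, 11001122, 100001212, 1001010221, 10001021210, 100001022101],
      111000000000111, 111000000111000⟩

theorem check_stdCert : stdCert.check = true := by decide +kernel

theorem check_lowCerts_0 : (lowCerts 0).all Certificate.check = true := by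
  decide +kernel

theorem check_lowCerts_1 : (lowCerts 1).all Certificate.check = true := by
  decide +kernel

theorem check_lowCerts_2 : (lowCerts 2).all Certificate.check = true := by
  decide +kernel

theorem check_lowCerts_3 : (lowCerts 3).all Certificate.check = true := by
  decide +kernel

theorem check_lowCerts_4 : (lowCerts 4).all Certificate.check = true := by
  decide +kernel

theorem check_lowCerts_5 : (lowCerts 5).all Certificate.check = true := by
  decide +kernel

theorem check_lowCerts_6 : (lowCerts 6).all Certificate.check = true := by
  decide +kernel

theorem check_lowCerts_7 : (lowCerts 7).all Certificate.check = true := by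
  decide +kernel

theorem check_lowCerts_8 : (lowCerts 8).all Certificate.check = true := by
  decide +kernel

theorem check_highCert_0 : (highCert 0).check = true := by decide +kernel

theorem check_highCert_1 : (highCert 1).check = true := by decide +kernel

theorem check_highCert_2 : (highCert 2).check = true := by decide +kernel

theorem check_highCert_3 : (highCert 3).check = true := by decide +kernel

theorem check_highCert_4 : (highCert 4).check = true := by decide +kernel

theorem check_highCert_5 : (highCert 5).check = true := by decide +kernel

theorem check_highCert_6 : (highCert 6).check = true := by decide +kernel

theorem check_highCert_7 : (highCert 7).check = true := by decide +kernel

theorem check_highCert_8 : (highCert 8).check = true := by decide +kernel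

theorem check_golayCert_0 : (golayCert 0).check = true := by decide +kernel

theorem check_golayCert_1 : (golayCert 1).check = true := by decide +kernel

theorem check_golayCert_2 : (golayCert 2).check = true := by decide +kernel

theorem check_golayCert_3 : (golayCert 3).check = true := by decide +kernel

theorem check_golayCert_4 : (golayCert 4).check = true := by decide +kernel

theorem check_golayCert_5 : (golayCert 5).check = true := by decide +kernel

theorem check_golayCert_6 : (golayCert 6).check = true := by decide +kernel

theorem check_golayCert_7 : (golayCert 7).check = true := by decide +kernel

theorem check_golayCert_8 : (golayCert 8).check = true := by decide +kernel


/-- The coordinates of the code from `golayCert ξ` in the order of the extended Golay code. -/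
def golayPos : ℕ → Fin 12 → ℕ
  | 0 => ![0, 1, 2, 3, 4, 11, 10, 6, 7, 8, 5, 9]
  | 1 => ![0, 1, 2, 3, 4, 7, 5, 8, 11, 6, 10, 9]
  | 2 => ![0, 1, 2, 3, 4, 5, 11, 10, 6, 7, 8, 9]
  | 3 => ![0, 1, 2, 3, 4, 10, 5, 8, 7, 11, 6, 9]
  | 4 => ![0, 1, 2, 3, 4, 8, 10, 5, 11, 6, 7, 9]
  | 5 => ![0, 1, 2, 3, 4, 11, 8, 9, 7, 5, 10, 6]
  | 6 => ![0, 1, 2, 3, 4, 7, 10, 6, 11, 9, 8, 5]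
  | 7 => ![0, 1, 2, 3, 4, 6, 10, 7, 11, 9, 8, 5]
  | _ => ![0, 1, 2, 3, 4, 9, 11, 7, 10, 6, 8, 5]

/-- The scalars making the code from `golayCert ξ` the extended Golay code. -/
def golayScale : ℕ → Fin 12 → (ZMod 3)ˣ
  | 0 => ![1, 1, -1, -1, 1, 1, 1, 1, -1, 1, -1, -1]
  | 1 => ![1, 1, -1, -1, 1, -1, 1, 1, 1, 1, -1, -1]
  | 2 => ![1, 1, -1, -1, 1, -1, 1, 1, -1, -1, -1, -1]
  | 3 => ![1, 1, -1, -1, 1, -1, 1, 1, 1, 1, -1, -1]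
  | 4 => ![1, 1, -1, -1, 1, -1, 1, -1, -1, -1, 1, -1]
  | 5 => ![1, 1, 1, 1, -1, 1, 1, 1, 1, 1, 1, 1]
  | 6 => ![1, 1, -1, -1, 1, -1, 1, -1, -1, -1, 1, -1]
  | 7 => ![1, 1, -1, -1, 1, -1, 1, -1, -1, -1, 1, -1]
  | _ => ![1, 1, -1, -1, 1, -1, -1, -1, 1, -1, 1, -1]

/-! ### Distances in terms of the coordinates with respect to the modified bases. -/

section Profiles

variable {F : Module.Basis ℕ (ZMod 3) (Seq 3)} {N ξ η : ℕ}

/-- A word with coordinate vector `y` is the image `y + y_ξ • e_η` of `y` under the transvection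
defining the basis, so only the coordinate `η` is affected. -/
theorem modBasis_repr (h : ξ ≠ η) (x : Seq 3) (i : ℕ) :
    x i = (modBasis 3 ξ η h).repr x i +
      if i = η then (modBasis 3 ξ η h).repr x ξ else 0 := by
  obtain ⟨y, rfl⟩ : ∃ y : Seq 3, y + y ξ • Finsupp.single η (1 : ZMod 3) = x :=
    ⟨_, LinearEquiv.apply_symm_apply (LinearEquiv.transvection
      (f := Finsupp.lapply (R := ZMod 3) ξ) (v := Finsupp.single η (1 : ZMod 3))
      (by simp [h.symm])) x⟩
  have hy : (modBasis 3 ξ η h).repr (y + y ξ • Finsupp.single η (1 : ZMod 3)) = y := by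
    change (stdBasis 3).repr (LinearEquiv.symm _ (LinearEquiv.transvection
      (f := Finsupp.lapply (R := ZMod 3) ξ) (v := Finsupp.single η (1 : ZMod 3))
      (by simp [h.symm]) y)) = y
    rw [LinearEquiv.symm_apply_apply]
    rfl
  rw [hy, Finsupp.add_apply, Finsupp.smul_apply, Finsupp.single_apply]
  by_cases hi : i = η
  · simp [hi]
  · simp [hi, Ne.symm hi]

theorem hdist_eq_sum {x y : Seq 3} (s : Finset ℕ) (hs : ∀ i, x i ≠ y i → i ∈ s) :
    hdist x y = ∑ i ∈ s, ind (x i ≠ y i) := by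
  classical
  have h : x.neLocus y = s.filter fun i => x i ≠ y i := by
    ext i
    simp only [Finsupp.mem_neLocus, Finset.mem_filter]
    exact ⟨fun h => ⟨hs i h, h⟩, And.right⟩
  rw [hdist, h, Finset.card_filter]
  exact Finset.sum_congr rfl fun i _ => by simp [ind]

/-- The profile of a basis whose coordinates below `N` are the standard ones. -/
theorem hasProfile_of_eq (h : ∀ x, Below F N x → ∀ i, x i = F.repr x i) :
    HasProfile F N N (N + 1) := by
  intro x y hx hy
  rw [hdist_eq_sum (Finset.range N) fun i hi => ?_, costFrom, Nat.Ico_zero_eq_range]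
  · refine Finset.sum_congr rfl fun i hi => ?_
    rw [Finset.mem_range] at hi
    have h1 : i ≠ N + 1 := by omega
    have h2 : i ≠ min N (N + 1) := by omega
    have h0 : ind (i = min N (N + 1) ∧
        F.repr x N + F.repr x (N + 1) ≠ F.repr y N + F.repr y (N + 1)) = 0 :=
      ind_neg fun h3 => h2 h3.1
    rw [stepCost, h0, add_zero, h x hx, h y hy]
    congr 1
    exact propext ⟨fun h3 => ⟨h1, h3⟩, And.right⟩
  · rw [h x hx, h y hy] at hi
    by_contra hiN
    rw [Finset.mem_range, not_lt] at hiN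
    exact hi ((hx i hiN).trans (hy i hiN).symm)

theorem hasProfile_stdBasis (N : ℕ) : HasProfile (stdBasis 3) N N (N + 1) :=
  hasProfile_of_eq fun _ _ _ => rfl

/-- Words below `N ≤ ξ` do not involve the modified basis vector. This reduces infinitely many bases
to the standard one. -/
theorem hasProfile_modBasis_of_le (h : ξ ≠ η) (hN : N ≤ ξ) :
    HasProfile (modBasis 3 ξ η h) N N (N + 1) :=
  hasProfile_of_eq fun x hx i => by
    rw [modBasis_repr h x i, hx ξ hN, ite_self, add_zero]

theorem costFrom_eq (hξ : min ξ η < N) (c z : Seq 3) :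
    costFrom N ξ η 0 c z = ∑ i ∈ Finset.range N, ind (i ≠ η ∧ c i ≠ z i) +
      ind (c ξ + c η ≠ z ξ + z η) := by
  rw [costFrom, Nat.Ico_zero_eq_range]
  simp only [stepCost]
  rw [Finset.sum_add_distrib]
  congr 1
  rw [Finset.sum_eq_single_of_mem (min ξ η) (Finset.mem_range.2 hξ)]
  · congr 1
    exact propext ⟨And.right, fun h => ⟨rfl, h⟩⟩
  · intro i _ hi
    exact ind_neg fun h => hi h.1

theorem hdist_modBasis (h : ξ ≠ η) {x y : Seq 3} (hx : Below (modBasis 3 ξ η h) N x)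
    (hy : Below (modBasis 3 ξ η h) N y) : hdist x y =
      ∑ i ∈ Finset.range N, ind (i ≠ η ∧
        (modBasis 3 ξ η h).repr x i ≠ (modBasis 3 ξ η h).repr y i) +
      ind ((modBasis 3 ξ η h).repr x ξ + (modBasis 3 ξ η h).repr x η ≠
        (modBasis 3 ξ η h).repr y ξ + (modBasis 3 ξ η h).repr y η) := by
  have hx' := modBasis_repr h x
  have hy' := modBasis_repr h y
  set r := (modBasis 3 ξ η h).repr x
  set s := (modBasis 3 ξ η h).repr y
  rw [hdist_eq_sum (insert η ((Finset.range N).erase η)) fun i hi => ?_,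
    Finset.sum_insert (Finset.notMem_erase _ _), add_comm]
  · congr 1
    · rw [← Finset.sum_subset (Finset.erase_subset η (Finset.range N))]
      · refine Finset.sum_congr rfl fun i hi => ?_
        have hi' := Finset.ne_of_mem_erase hi
        rw [hx', hy', if_neg hi', if_neg hi', add_zero, add_zero]
        congr 1
        exact propext ⟨fun h => ⟨hi', h⟩, And.right⟩
      · intro i hi hi'
        refine ind_neg fun h => hi' (Finset.mem_erase.2 ⟨h.1, hi⟩)
    · rw [hx', hy', if_pos rfl, if_pos rfl, add_comm (r η), add_comm (s η)]
  · by_cases hi' : i = η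
    · exact hi' ▸ Finset.mem_insert_self _ _
    · rw [hx', hy', if_neg hi', if_neg hi', add_zero, add_zero] at hi
      refine Finset.mem_insert_of_mem (Finset.mem_erase.2 ⟨hi', ?_⟩)
      rw [Finset.mem_range]
      by_contra hiN
      rw [not_lt] at hiN
      exact hi ((hx i hiN).trans (hy i hiN).symm)

theorem hasProfile_modBasis (h : ξ ≠ η) (hN : ξ < N) : HasProfile (modBasis 3 ξ η h) N ξ η := by
  intro x y hx hy
  rw [costFrom_eq (by omega), hdist_modBasis h hx hy]

/-- For words below `N ≤ η` the coordinate `η` vanishes, so its exact position is immaterial and `η`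
may be replaced by `N`. One certificate thus serves all these `η`. -/
theorem hasProfile_modBasis_of_ge (h : ξ ≠ η) (hN : ξ < N) (hη : N ≤ η) :
    HasProfile (modBasis 3 ξ η h) N ξ N := by
  intro x y hx hy
  rw [costFrom_eq (by omega), hdist_modBasis h hx hy, hx η hη, hy η hη, hx N le_rfl, hy N le_rfl]
  congr 1
  refine Finset.sum_congr rfl fun i hi => ?_
  rw [Finset.mem_range] at hi
  congr 1
  have h1 : i ≠ η := by omega
  have h2 : i ≠ N := by omega
  exact propext (and_congr_left fun _ => ⟨fun _ => h2, fun _ => h1⟩)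

end Profiles

/-! ### Identification with the extended ternary Golay code. -/

section Golay

/-- Because `golayMatrix` is in systematic form `[I₆ | A]`, a vector lies in its row space exactly
when it is the combination of the rows with its own first six entries as coefficients. The summand
at position `9` converts `F(ξ, 9)`-coordinates into standard ones. -/
theorem golay_data : ∀ ξ < 9, (∀ i < 12, ∃ j, golayPos ξ j = i) ∧
    (∀ j, golayPos ξ j < 12) ∧ (∀ j k, golayPos ξ j = golayPos ξ k → j = k) ∧
    ∀ b ∈ (golayCert ξ).bs, ∀ j, (golayScale ξ j : ZMod 3) *
        ((dig b (golayPos ξ j) : ZMod 3) + if golayPos ξ j = 9 then (dig b ξ : ZMod 3) else 0) =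
      ∑ l : Fin 6, (golayScale ξ (l.castLE (by norm_num)) : ZMod 3) *
        ((dig b (golayPos ξ (l.castLE (by norm_num))) : ZMod 3) +
          if golayPos ξ (l.castLE (by norm_num)) = 9 then (dig b ξ : ZMod 3) else 0) *
        golayMatrix l j := by
  decide +kernel

theorem exists_golayMatrix_ne_zero : ∀ j, ∃ l, golayMatrix l j ≠ 0 := by
  decide +kernel

theorem ncard_extendedTernaryGolay_le :
    (extendedTernaryGolay : Set (Fin 12 → ZMod 3)).ncard ≤ 3 ^ 6 := by
  have h := Module.natCard_eq_pow_finrank (K := ZMod 3) (V := extendedTernaryGolay)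
  have hr : Module.finrank (ZMod 3) extendedTernaryGolay ≤ 6 := by
    exact (finrank_range_le_card (R := ZMod 3) (b := golayMatrix)).trans_eq (Fintype.card_fin 6)
  rw [Nat.card_zmod] at h
  change Nat.card extendedTernaryGolay ≤ 3 ^ 6
  rw [h]
  exact Nat.pow_le_pow_right (by norm_num) hr

/-- A code is the extended Golay code if some monomial map sends it into the latter and the
cardinality is right. -/
theorem isExtendedTernaryGolay_of_map {V : Submodule (ZMod 3) (Seq 3)}
    (hcard : (V : Set (Seq 3)).ncard = 3 ^ 6) (hsupp : ∀ x ∈ V, ∀ i, 12 ≤ i → x i = 0)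
    (π : Fin 12 → ℕ) (u : Fin 12 → (ZMod 3)ˣ) (hlt : ∀ j, π j < 12) (hinj : Function.Injective π)
    (hsurj : ∀ i < 12, ∃ j, π j = i)
    (hmap : ∀ x ∈ V, (fun j => (u j : ZMod 3) * x (π j)) ∈ extendedTernaryGolay) :
    IsExtendedTernaryGolay (Res (V : Set (Seq 3))) := by
  set φ : Seq 3 → Fin 12 → ZMod 3 := fun x j => (u j : ZMod 3) * x (π j)
  -- The map is injective on `V`, whose words vanish from coordinate 12 on. Its image therefore has
  -- `3 ^ 6` elements, at least as many as the row space containing it.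
  have himage : φ '' (V : Set (Seq 3)) = extendedTernaryGolay := by
    refine Set.eq_of_subset_of_ncard_le (Set.image_subset_iff.2 hmap) ?_ (Set.toFinite _)
    rw [Set.InjOn.ncard_image, hcard]
    · exact ncard_extendedTernaryGolay_le
    · intro x hx y hy hxy
      ext i
      by_cases hi : i < 12
      · obtain ⟨j, rfl⟩ := hsurj i hi
        exact (u j).isUnit.mul_left_cancel (congr_fun hxy j)
      · rw [hsupp x hx i (not_lt.1 hi), hsupp y hy i (not_lt.1 hi)]
  have hmem : ∀ i, i ∈ codeSupp (V : Set (Seq 3)) ↔ i < 12 := by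
    intro i
    constructor
    · rintro ⟨x, hx, hxi⟩
      by_contra hi
      exact hxi (hsupp x hx i (not_lt.1 hi))
    · intro hi
      obtain ⟨j, rfl⟩ := hsurj i hi
      -- No column of the generator matrix vanishes and the rows are images of words of `V`, so each
      -- of the twelve coordinates is in the support.
      obtain ⟨l, hl⟩ := exists_golayMatrix_ne_zero j
      have hrow : golayMatrix l ∈ (extendedTernaryGolay : Set (Fin 12 → ZMod 3)) :=
        Submodule.subset_span ⟨l, rfl⟩
      rw [← himage] at hrow
      obtain ⟨x, hx, hxl⟩ := hrow
      refine ⟨x, hx, fun h0 => hl ?_⟩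
      rw [← hxl]
      simp [φ, h0]
  have hbij : Function.Bijective
      (fun j => ⟨π j, (hmem _).2 (hlt j)⟩ : Fin 12 → codeSupp (V : Set (Seq 3))) := by
    refine ⟨fun j k hjk => hinj (congr_arg Subtype.val hjk), fun i => ?_⟩
    obtain ⟨j, hj⟩ := hsurj i.1 ((hmem _).1 i.2)
    exact ⟨j, Subtype.ext hj⟩
  refine ⟨(Equiv.ofBijective _ hbij).symm, u, ?_⟩
  ext y
  rw [Equiv.symm_symm]
  constructor
  · rintro ⟨x, hx, rfl⟩
    exact hmap x hx
  · intro hy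
    change _ ∈ (extendedTernaryGolay : Set (Fin 12 → ZMod 3)) at hy
    rw [← himage] at hy
    obtain ⟨x, hx, hxy⟩ := hy
    refine ⟨x, hx, funext fun i => ?_⟩
    obtain ⟨j, rfl⟩ := hbij.2 i
    exact (u j).isUnit.mul_left_cancel (congr_fun hxy j)

theorem forall_lt_nine {P : ℕ → Prop} (h0 : P 0) (h1 : P 1) (h2 : P 2) (h3 : P 3) (h4 : P 4)
    (h5 : P 5) (h6 : P 6) (h7 : P 7) (h8 : P 8) : ∀ ξ < 9, P ξ := by
  intro ξ hξ
  interval_cases ξ <;> assumption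

theorem check_golayCert : ∀ ξ < 9, (golayCert ξ).check = true :=
  forall_lt_nine check_golayCert_0 check_golayCert_1 check_golayCert_2 check_golayCert_3
    check_golayCert_4 check_golayCert_5 check_golayCert_6 check_golayCert_7 check_golayCert_8

theorem golayCert_params : ∀ ξ < 9, (golayCert ξ).N = 15 ∧ (golayCert ξ).n = 12 ∧
    (golayCert ξ).ξ = ξ ∧ (golayCert ξ).η = 9 ∧ (golayCert ξ).bs.length = 6 := by
  decide

theorem hasProfile_golayCert {ξ : ℕ} (h : ξ ≠ 9) (hξ : ξ < 9) :
    HasProfile (modBasis 3 ξ 9 h) (golayCert ξ).N (golayCert ξ).ξ (golayCert ξ).η := by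
  obtain ⟨h1, -, h2, h3, -⟩ := golayCert_params ξ hξ
  rw [h1, h2, h3]
  exact hasProfile_modBasis h (by omega)

theorem isExtendedTernaryGolay_lexCode {ξ : ℕ} (h : ξ ≠ 9) (hξ : ξ < 9) :
    IsExtendedTernaryGolay (Res (lexCode (modBasis 3 ξ 9 h) 6 6)) := by
  have hL := Certificate.lexCode_eq (hasProfile_golayCert h hξ) (check_golayCert ξ hξ)
  obtain ⟨-, hn, -, -, hlen⟩ := golayCert_params ξ hξ
  obtain ⟨hsurj, hlt, hinj, hmap⟩ := golay_data ξ hξ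
  rw [hlen] at hL
  have hcard : (code (modBasis 3 ξ 9 h) (golayCert ξ).bs : Set (Seq 3)).ncard = 3 ^ 6 := by
    rw [← hL, ncard_lexCode (by norm_num)]
  have hb : ∀ b ∈ (golayCert ξ).bs, b < 10 ^ 12 := by
    have h1 := check_golayCert ξ hξ
    have h2 : (golayCert ξ).checkShape = true := by
      simp only [Certificate.check, Bool.and_eq_true] at h1
      exact h1.1.1.1.1
    have := (Certificate.shape h2).2.2.2.2.2.1
    rwa [hn] at this
  rw [hL]
  refine isExtendedTernaryGolay_of_map hcard (fun x hx i hi => ?_) (golayPos ξ) (golayScale ξ) hlt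
    hinj hsurj fun x hx => ?_
  · rw [modBasis_repr h x i, if_neg (by omega), add_zero]
    exact eq_zero_of_mem_codeSpan hb (mem_code.1 hx) hi
  · let ψ : Seq 3 →ₗ[ZMod 3] Fin 12 → ZMod 3 :=
      { toFun := fun c j => (golayScale ξ j : ZMod 3) *
          (c (golayPos ξ j) + if golayPos ξ j = 9 then c ξ else 0)
        map_add' := fun c c' => funext fun j => by
          simp only [Finsupp.add_apply, Pi.add_apply]
          split_ifs <;> ring
        map_smul' := fun a c => funext fun j => by
          simp only [Finsupp.smul_apply, Pi.smul_apply, smul_eq_mul, RingHom.id_apply]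
          split_ifs <;> ring }
    have hle : codeSpan (golayCert ξ).bs ≤ extendedTernaryGolay.comap ψ := by
      refine Submodule.span_le.2 ?_
      rintro _ ⟨b, hbm, rfl⟩
      have hrow : ψ (coord b) = ∑ l : Fin 6, ψ (coord b) (l.castLE (by norm_num)) •
          golayMatrix l := by
        ext j
        rw [Finset.sum_apply]
        exact hmap b hbm j
      rw [SetLike.mem_coe, Submodule.mem_comap, hrow]
      exact Submodule.sum_mem _ fun l _ =>
        Submodule.smul_mem _ _ (Submodule.subset_span ⟨l, rfl⟩)
    have := hle (mem_code.1 hx)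
    rw [Submodule.mem_comap] at this
    convert this using 1
    ext j
    rw [modBasis_repr h x]
    rfl

end Golay

/-! ### Assembling the maximal dimensions. -/

section MaxDim

theorem maxDim_of_shear_nine {ξ : ℕ} (h : ξ ≠ 9) (hξ : ξ < 9) :
    maxDim (modBasis 3 ξ 9 h) 6 = 6 := by
  rw [Certificate.maxDim_eq (hasProfile_golayCert h hξ) (check_golayCert ξ hξ),
    (golayCert_params ξ hξ).2.2.2.2]
  rfl

theorem check_highCert : ∀ ξ < 9, (highCert ξ).check = true :=
  forall_lt_nine check_highCert_0 check_highCert_1 check_highCert_2 check_highCert_3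
    check_highCert_4 check_highCert_5 check_highCert_6 check_highCert_7 check_highCert_8

theorem highCert_params : ∀ ξ < 9, (highCert ξ).N = 10 ∧ (highCert ξ).ξ = ξ ∧
    (highCert ξ).η = 10 ∧ (highCert ξ).bs.length = 3 := by
  decide

theorem maxDim_of_shear_high {ξ η : ℕ} (h : ξ ≠ η) (hξ : ξ < 9) (hη : 10 ≤ η) :
    maxDim (modBasis 3 ξ η h) 6 = 3 := by
  obtain ⟨h1, h2, h3, h4⟩ := highCert_params ξ hξ
  have hF : HasProfile (modBasis 3 ξ η h) (highCert ξ).N (highCert ξ).ξ (highCert ξ).η := by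
    rw [h1, h2, h3]
    exact hasProfile_modBasis_of_ge h (by omega) hη
  rw [Certificate.maxDim_eq hF (check_highCert ξ hξ), h4]
  rfl

theorem check_lowCerts : ∀ ξ < 9, (lowCerts ξ).all Certificate.check = true :=
  forall_lt_nine check_lowCerts_0 check_lowCerts_1 check_lowCerts_2 check_lowCerts_3
    check_lowCerts_4 check_lowCerts_5 check_lowCerts_6 check_lowCerts_7 check_lowCerts_8

theorem any_lowCerts : ∀ ξ < 9, ∀ η < 9, (ξ == η || (lowCerts ξ).any fun R =>
    R.N == 9 && R.ξ == ξ && R.η == η && R.bs.length == 2) = true := by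
  decide +kernel

theorem exists_lowCert {ξ η : ℕ} (h : ξ ≠ η) (hξ : ξ < 9) (hη : η < 9) :
    ∃ R ∈ lowCerts ξ, R.N = 9 ∧ R.ξ = ξ ∧ R.η = η ∧ R.bs.length = 2 := by
  simpa [h, and_assoc] using any_lowCerts ξ hξ η hη

theorem maxDim_of_shear_low {ξ η : ℕ} (h : ξ ≠ η) (hξ : ξ < 9) (hη : η < 9) :
    maxDim (modBasis 3 ξ η h) 6 = 2 := by
  obtain ⟨R, hR, h1, h2, h3, h4⟩ := exists_lowCert h hξ hη
  have hF : HasProfile (modBasis 3 ξ η h) R.N R.ξ R.η := by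
    rw [h1, h2, h3]
    exact hasProfile_modBasis h hξ
  rw [Certificate.maxDim_eq hF (List.all_eq_true.1 (check_lowCerts ξ hξ) R hR), h4]
  rfl

theorem maxDim_of_profile_std {F : Module.Basis ℕ (ZMod 3) (Seq 3)} (hF : HasProfile F 9 9 10) :
    maxDim F 6 = 2 :=
  Certificate.maxDim_eq (R := stdCert) hF check_stdCert

theorem maxDim_modBasis {ξ η : ℕ} (h : ξ ≠ η) : maxDim (modBasis 3 ξ η h) 6 =
    if ξ ≤ 8 ∧ η = 9 then 6 else if ξ ≤ 8 ∧ 10 ≤ η then 3 else 2 := by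
  by_cases hξ : ξ ≤ 8
  · obtain hη | rfl | hη : η < 9 ∨ η = 9 ∨ 10 ≤ η := by omega
    · rw [if_neg (by omega), if_neg (by omega)]
      exact maxDim_of_shear_low h (by omega) hη
    · rw [if_pos ⟨hξ, rfl⟩]
      exact maxDim_of_shear_nine h (by omega)
    · rw [if_neg (by omega), if_pos ⟨hξ, hη⟩]
      exact maxDim_of_shear_high h (by omega) hη
  · rw [if_neg (by omega), if_neg (by omega)]
    exact maxDim_of_profile_std (hasProfile_modBasis_of_le h (by omega))

theorem modBasis_ne_stdBasis {ξ η : ℕ} (h : ξ ≠ η) : modBasis 3 ξ η h ≠ stdBasis 3 := by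
  intro heq
  have h1 := modBasis_apply 3 ξ η h ξ
  rw [heq, if_pos rfl] at h1
  have h2 : (stdBasis 3 ξ : Seq 3) η = (Finsupp.single ξ 1 + Finsupp.single η 1 : Seq 3) η := by
    rw [h1]
  simp [stdBasis, h] at h2

/-- The basis determines the pair: `ξ` is the index of the only nonstandard vector, and `η` is read
off from that vector. Hence the existential cases of the theorem become conditions on the given `ξ`
and `η`. -/
theorem modBasis_inj {ξ η ξ' η' : ℕ} (h : ξ ≠ η) (h' : ξ' ≠ η')
    (heq : modBasis 3 ξ η h = modBasis 3 ξ' η' h') : ξ = ξ' ∧ η = η' := by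
  have hξ : ξ = ξ' := by
    by_contra hne
    have h1 := modBasis_apply 3 ξ η h ξ
    rw [heq, if_pos rfl, modBasis_apply, if_neg hne] at h1
    have h2 : (Finsupp.single ξ 1 : Seq 3) η =
      (Finsupp.single ξ 1 + Finsupp.single η 1 : Seq 3) η := by rw [← h1]
    simp at h2
  subst hξ
  refine ⟨rfl, ?_⟩
  have h1 := modBasis_apply 3 ξ η h ξ
  rw [heq, modBasis_apply, if_pos rfl, if_pos rfl] at h1
  have h2 := congr_fun (congr_arg DFunLike.coe (add_left_cancel h1)) η
  by_contra hne
  simp [Ne.symm hne] at h2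

end MaxDim

end Lexicode

open Classical in
theorem theorem1p6 :
    (∀ F ∈ Lexicode.basisFamily 3,
      Lexicode.maxDim F 6 =
        if ∃ (ξ : ℕ) (h : ξ ≠ 9), ξ ≤ 8 ∧ F = Lexicode.modBasis 3 ξ 9 h then 6
        else if ∃ (ξ η : ℕ) (h : ξ ≠ η), ξ ≤ 8 ∧ 10 ≤ η ∧ F = Lexicode.modBasis 3 ξ η h then 3
        else 2) ∧
    (∀ (ξ : ℕ) (h : ξ ≠ 9), ξ ≤ 8 →
      Lexicode.IsExtendedTernaryGolay
        (Lexicode.Res (Lexicode.lexCode (Lexicode.modBasis 3 ξ 9 h) 6 6))) := by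
  refine ⟨?_, fun ξ h hξ => Lexicode.isExtendedTernaryGolay_lexCode h (by omega)⟩
  rintro F (rfl | ⟨ξ, η, h, rfl⟩)
  · rw [if_neg, if_neg, Lexicode.maxDim_of_profile_std (Lexicode.hasProfile_stdBasis 9)]
    · rintro ⟨ξ, η, h, -, -, heq⟩
      exact Lexicode.modBasis_ne_stdBasis h heq.symm
    · rintro ⟨ξ, h, -, heq⟩
      exact Lexicode.modBasis_ne_stdBasis h heq.symm
  · have h1 : (∃ (ξ' : ℕ) (h' : ξ' ≠ 9), ξ' ≤ 8 ∧
        Lexicode.modBasis 3 ξ η h = Lexicode.modBasis 3 ξ' 9 h') ↔ ξ ≤ 8 ∧ η = 9 := by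
      constructor
      · rintro ⟨ξ', h', hξ', heq⟩
        obtain ⟨rfl, rfl⟩ := Lexicode.modBasis_inj h h' heq
        exact ⟨hξ', rfl⟩
      · rintro ⟨hξ, rfl⟩
        exact ⟨ξ, h, hξ, rfl⟩
    have h2 : (∃ (ξ' η' : ℕ) (h' : ξ' ≠ η'), ξ' ≤ 8 ∧ 10 ≤ η' ∧
        Lexicode.modBasis 3 ξ η h = Lexicode.modBasis 3 ξ' η' h') ↔ ξ ≤ 8 ∧ 10 ≤ η := by
      constructor
      · rintro ⟨ξ', η', h', hξ', hη', heq⟩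
        obtain ⟨rfl, rfl⟩ := Lexicode.modBasis_inj h h' heq
        exact ⟨hξ', hη'⟩
      · rintro ⟨hξ, hη⟩
        exact ⟨ξ, η, h, hξ, hη, rfl⟩
    simp only [h1, h2]
    exact Lexicode.maxDim_modBasis h
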